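/- Let $b\in\mathbb C$ with $\operatorname{Re} b>-1/2$, let $H$ be an entire function without zeros in $\mathbb C\setminus\{0,1\}$, and let $$\nu(z)=(-z)^{-\overline b}(1-z)^{b+\overline b}H(z)$$ (principal powers for $z\in\mathbb T\setminus\{1\}$, where $\mathbb T$ is the positively oriented unit circle). Let $\{\Phi_k\}_{k\ge0}$, $\{\Psi_k\}_{k\ge0}$ be monic polynomials, $\deg\Phi_k=\deg\Psi_k=k$, with $$\int_{\mathbb T}\Phi_k(z)\overline{\Psi_m(z)}\,\frac{\nu(z)}{\mathrm i z}\,\mathrm dz=\kappa_k^{-2}\,\delta_{k,m},\qquad \kappa_k^{-2}\in\mathbb C\setminus\{0\},\quad k,m\ge 0 ;$$ if $\nu$ is a positive weight on $\mathbb T$ then $\Psi_k=\Phi_k$ are the monic orthogonal polynomials on the unit circle and $\kappa_k>0$. Put $\Psi_k^*(z)=z^k\,\overline{\Psi_k(1/\overline z)}$ and, for $n\ge1$ and $z\in\mathbb C\setminus\mathbb T$, $$Y_n(z)=\begin{bmatrix}\Phi_n(z)&\dfrac1{2\pi \mathrm i}\displaystyle\int_{\mathbb T}\frac{\Phi_n(t)}{t-z}\frac{\nu(t)}{t^n}\,\mathrm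 dt\\[2mm]-2\pi\kappa_{n-1}^2\Psi_{n-1}^*(z)&-2\pi\kappa_{n-1}^2\,\dfrac1{2\pi \mathrm i}\displaystyle\int_{\mathbb T}\frac{\Psi^*_{n-1}(t)}{t-z}\frac{\nu(t)}{t^n}\,\mathrm dt\end{bmatrix},\qquad C_n(z)=\begin{bmatrix}z^{-n/2}\nu(z)^{1/2}&0\\0&z^{n/2}\nu(z)^{-1/2}\end{bmatrix},$$ $Z_n=Y_nC_n$ and $M_n=Z_n'Z_n^{-1}$ on $\mathbb C\setminus(\mathbb T\cup\{0\})$, where near each point any holomorphic branches of the powers in $C_n$ are taken. Then, for every $n\ge1$, $M_n$ does not depend on the choice of the branches and extends to a holomorphic matrix function on $\mathbb C\setminus\{0,1\}$, which has a simple pole at $z=0$ and either a removable singularity or a simple pole at $z=1$. -/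

import Mathlib

open Complex Polynomial Topology Filter ComplexConjugate

/-- The generalized modified Jacobi weight `ν(z) = (-z)^{-b̄} (1-z)^{b+b̄} H(z)`, with principal
powers. On the unit circle, `z = e^{iθ}` with `0 < θ < 2π`, both powers are away from their cuts and
`(-z)^{-b̄} (1-z)^{b+b̄} = e^{-η(θ-π)} (2 sin (θ/2))^{2λ}` for `b = λ + iη`. -/
noncomputable def jacobiWeight (b : ℂ) (H : ℂ → ℂ) (z : ℂ) : ℂ :=
  (-z) ^ (-conj b) * (1 - z) ^ (b + conj b) * H z

/-- `Φ` and `Ψ` are the two sequences of monic polynomials, biorthogonal on the unit circle for the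
(possibly complex) weight `ν`:
`∫_𝕋 Φ_k(z) conj(Ψ_m(z)) ν(z)/(iz) dz = h_k δ_{k,m}` with `h_k ≠ 0`.
For a positive weight `Ψ = Φ` is the sequence of monic orthogonal polynomials and
`h_k = κ_k⁻²`. -/
structure IsBiorthogonal (ν : ℂ → ℂ) (Φ Ψ : ℕ → ℂ[X]) (h : ℕ → ℂ) : Prop where
  monic_left : ∀ k, (Φ k).Monic
  monic_right : ∀ k, (Ψ k).Monic
  degree_left : ∀ k, (Φ k).natDegree = k
  degree_right : ∀ k, (Ψ k).natDegree = k
  norm_ne_zero : ∀ k, h k ≠ 0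
  orthogonal : ∀ k m,
    (∮ z in C(0, 1), (Φ k).eval z * conj ((Ψ m).eval z) * (ν z / (I * z)))
      = if k = m then h k else 0

/-- The reciprocal polynomial `P^*(z) = z^k conj(P(1/z̄))` of a polynomial `P` of degree `k`. -/
noncomputable def recip (k : ℕ) (P : ℂ[X]) : ℂ[X] :=
  (P.map (starRingEnd ℂ)).reflect k

/-- The function `z ↦ (1/2πi) ∫_𝕋 P(t)/(t-z) ν(t)/t^n dt` associated with a polynomial `P`. -/
noncomputable def assocFun (ν : ℂ → ℂ) (n : ℕ) (P : ℂ[X]) (z : ℂ) : ℂ :=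
  (2 * Real.pi * I)⁻¹ * ∮ t in C(0, 1), P.eval t / (t - z) * (ν t / t ^ n)

/-- The matrix `Y_n` (for `n ≥ 1`, off the unit circle), with `b_{n-1} = 2π / h_{n-1}`
in the role of `2π κ_{n-1}²`. -/
noncomputable def Ymat (ν : ℂ → ℂ) (Φ Ψ : ℕ → ℂ[X]) (h : ℕ → ℂ) (n : ℕ) (z : ℂ) :
    Matrix (Fin 2) (Fin 2) ℂ :=
  !![(Φ n).eval z, assocFun ν n (Φ n) z;
     -(2 * Real.pi / h (n - 1)) * (recip (n - 1) (Ψ (n - 1))).eval z,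
     -(2 * Real.pi / h (n - 1)) * assocFun ν n (recip (n - 1) (Ψ (n - 1))) z]

/-- `C` is, near `z₀`, a holomorphic determination of
`C_n(z) = diag(z^{-n/2} ν(z)^{1/2}, z^{n/2} ν(z)^{-1/2})`: the functions `L₀`, `L₁`, `L₂` are
holomorphic logarithms of `z`, `-z`, `1 - z` near `z₀` and `r` is a holomorphic square root of
`ν(z) = (-z)^{-b̄} (1-z)^{b+b̄} H(z)`, with the powers taken through these logarithms. -/
def IsCBranchAt (b : ℂ) (H : ℂ → ℂ) (n : ℕ) (z₀ : ℂ) (C : ℂ → Matrix (Fin 2) (Fin 2) ℂ) : Prop :=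
  ∃ L₀ L₁ L₂ r : ℂ → ℂ,
    AnalyticAt ℂ L₀ z₀ ∧ AnalyticAt ℂ L₁ z₀ ∧ AnalyticAt ℂ L₂ z₀ ∧ AnalyticAt ℂ r z₀ ∧
    ∀ᶠ z in 𝓝 z₀,
      exp (L₀ z) = z ∧ exp (L₁ z) = -z ∧ exp (L₂ z) = 1 - z ∧
      r z ^ 2 = exp (-conj b * L₁ z) * exp ((b + conj b) * L₂ z) * H z ∧
      C z = !![exp (-(n / 2 : ℂ) * L₀ z) * r z, 0; 0, exp ((n / 2 : ℂ) * L₀ z) * (r z)⁻¹]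

/-- The entrywise derivative of a matrix function. -/
noncomputable def matDeriv (Z : ℂ → Matrix (Fin 2) (Fin 2) ℂ) (z : ℂ) : Matrix (Fin 2) (Fin 2) ℂ :=
  Matrix.of fun i j => deriv (fun w => Z w i j) z

/-- `m` is the value at `z₀` of the structure matrix `M_n = Z_n' Z_n⁻¹`, where `Z_n = Y_n C_n`:
there are holomorphic determinations of `C_n` near `z₀` and each of them yields `m`. -/
def IsStructureMatrixAt (b : ℂ) (H : ℂ → ℂ) (Φ Ψ : ℕ → ℂ[X]) (h : ℕ → ℂ) (n : ℕ) (z₀ : ℂ)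
    (m : Matrix (Fin 2) (Fin 2) ℂ) : Prop :=
  (∃ C, IsCBranchAt b H n z₀ C) ∧
  ∀ C, IsCBranchAt b H n z₀ C →
    m = matDeriv (fun z => Ymat (jacobiWeight b H) Φ Ψ h n z * C z) z₀ *
      (Ymat (jacobiWeight b H) Φ Ψ h n z₀ * C z₀)⁻¹

/-- The matrix function `M` has a removable singularity at `z₀`. -/
def HasRemovableSingularityAt (M : ℂ → Matrix (Fin 2) (Fin 2) ℂ) (z₀ : ℂ) : Prop :=
  ∀ i j, MeromorphicAt (fun z => M z i j) z₀ ∧ 0 ≤ meromorphicOrderAt (fun z => M z i j) z₀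

/-- The matrix function `M` has a simple pole at `z₀`: no entry has a pole of order greater than
one, and some entry has a pole of order one. -/
def HasSimplePoleAt (M : ℂ → Matrix (Fin 2) (Fin 2) ℂ) (z₀ : ℂ) : Prop :=
  (∀ i j, MeromorphicAt (fun z => M z i j) z₀ ∧ -1 ≤ meromorphicOrderAt (fun z => M z i j) z₀) ∧
  ∃ i j, meromorphicOrderAt (fun z => M z i j) z₀ = -1

/-!
The density `w(t) = ν(t) / t ^ n` satisfies a Pearson equation `z (1 - z) w' = V w` whose
coefficient `V` is entire because the zeros of `H` lie in `{0, 1}`. Integrating by parts, the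
entries of `z (1 - z) M_n = z (1 - z) Y_n' adj Y_n + (V / 2) Y_n σ₃ adj Y_n`, which are bilinear in
the polynomials of the first column of `Y_n` and their Cauchy transforms, become integrals of `w`
against difference quotients, hence entire. Since `det Y_n = 1`, the value of this matrix at `0` has
determinant `-(V(0) / 2) ^ 2`. Here `V(0) = p - n - b̄` with `p` the order of `H` at `0`, and it
does not vanish: otherwise `ν(z) / z` would be the restriction of an entire function to the circle,
contradicting the nonvanishing of the zeroth moment.
-/

section Holomorphy

open MeasureTheory Metric

theorem hasDerivAt_integral_of_differentiableOn_of_norm_le {α E : Type*} [MeasurableSpace α]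
    {μ : Measure α} [NormedAddCommGroup E] [NormedSpace ℂ E] {F : ℂ → α → E} {z₀ : ℂ} {r : ℝ}
    {bound : α → ℝ} (hr : 0 < r) (hmeas : ∀ z ∈ ball z₀ r, AEStronglyMeasurable (F z) μ)
    (hdiff : ∀ᵐ a ∂μ, DifferentiableOn ℂ (F · a) (ball z₀ r))
    (hnorm : ∀ᵐ a ∂μ, ∀ z ∈ ball z₀ r, ‖F z a‖ ≤ bound a) (hbound : Integrable bound μ) :
    HasDerivAt (fun z => ∫ a, F z a ∂μ) (∫ a, deriv (F · a) z₀ ∂μ) z₀ := by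
  have hz₀ : z₀ ∈ ball z₀ r := mem_ball_self hr
  have hball : ∀ᶠ z in 𝓝[≠] z₀, z ∈ ball z₀ r := nhdsWithin_le_nhds (ball_mem_nhds z₀ hr)
  have hint : ∀ z ∈ ball z₀ r, Integrable (F z) μ := fun z hz =>
    hbound.mono' (hmeas z hz) (hnorm.mono fun a ha => ha z hz)
  have hslope : ∀ᶠ z in 𝓝[≠] z₀,
      ∫ a, slope (F · a) z₀ z ∂μ = slope (fun z => ∫ a, F z a ∂μ) z₀ z := by
    filter_upwards [hball] with z hz
    simp only [slope_def_module]
    rw [integral_smul, integral_sub (hint z hz) (hint z₀ hz₀)]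
  refine hasDerivAt_iff_tendsto_slope.2 (Tendsto.congr' hslope ?_)
  refine tendsto_integral_filter_of_dominated_convergence (fun a => 2 * bound a / r) ?_ ?_
    ((hbound.const_mul 2).div_const r) ?_
  · filter_upwards [hball] with z hz
    simp only [slope_def_module]
    exact ((hmeas z hz).sub (hmeas z₀ hz₀)).const_smul _
  · filter_upwards [hball, self_mem_nhdsWithin] with z hz hne
    filter_upwards [hdiff, hnorm] with a hd hle
    rw [← dslope_of_ne _ hne]
    refine norm_dslope_le_div_of_mapsTo_ball hd (fun y hy => ?_) hz
    rw [mem_closedBall_iff_norm, two_mul]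
    exact (norm_sub_le _ _).trans (add_le_add (hle y hy) (hle z₀ hz₀))
  · filter_upwards [hdiff] with a hd
    exact hasDerivAt_iff_tendsto_slope.1
      (hd.differentiableAt (isOpen_ball.mem_nhds hz₀)).hasDerivAt

theorem hasDerivAt_circleIntegral_mul {K : ℂ → ℂ → ℂ} {w : ℂ → ℂ} {c z₀ : ℂ} {R r B : ℝ}
    (hw : CircleIntegrable w c R) (hr : 0 < r)
    (hcont : ∀ z ∈ ball z₀ r, ContinuousOn (K z) (sphere c |R|))
    (hdiff : ∀ t ∈ sphere c |R|, DifferentiableOn ℂ (K · t) (ball z₀ r))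
    (hB : ∀ z ∈ ball z₀ r, ∀ t ∈ sphere c |R|, ‖K z t‖ ≤ B) :
    HasDerivAt (fun z => ∮ t in C(c, R), K z t * w t)
      (∮ t in C(c, R), deriv (K · t) z₀ * w t) z₀ := by
  have hsphere : ∀ θ : ℝ, circleMap c R θ ∈ sphere c |R| := circleMap_mem_sphere' c R
  have hKw : ∀ z ∈ ball z₀ r, CircleIntegrable (fun t => K z t * w t) c R := fun z hz =>
    hw.continuousOn_mul (hcont z hz)
  have hderiv : ∀ θ : ℝ, HasDerivAt
      (fun z => deriv (circleMap c R) θ • (K z (circleMap c R θ) * w (circleMap c R θ)))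
      (deriv (circleMap c R) θ • (deriv (K · (circleMap c R θ)) z₀ * w (circleMap c R θ))) z₀ :=
    fun θ => (((hdiff _ (hsphere θ)).differentiableAt
      (ball_mem_nhds z₀ hr)).hasDerivAt.mul_const _).fun_const_smul _
  simp only [circleIntegral, intervalIntegral.integral_of_le Real.two_pi_pos.le]
  simp only [← (hderiv _).deriv]
  refine hasDerivAt_integral_of_differentiableOn_of_norm_le
    (bound := fun θ => |R| * (B * ‖w (circleMap c R θ)‖)) hr
    (fun z hz => ((intervalIntegrable_iff_integrableOn_Ioc_of_le Real.two_pi_pos.le).1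
      (hKw z hz).out).aestronglyMeasurable) ?_ ?_ ?_
  · exact Eventually.of_forall fun θ =>
      ((hdiff _ (hsphere θ)).mul_const _).const_smul (deriv (circleMap c R) θ)
  · refine Eventually.of_forall fun θ z hz => ?_
    rw [norm_smul, norm_mul, deriv_circleMap, norm_mul, norm_I, mul_one, norm_circleMap_zero]
    gcongr
    exact hB z hz _ (hsphere θ)
  · exact ((((intervalIntegrable_iff_integrableOn_Ioc_of_le Real.two_pi_pos.le).1
      hw).norm.const_mul B).const_mul |R|)

end Holomorphy

section CauchyTransform

open Metric

variable {c : ℂ} {R : ℝ} {w f g : ℂ → ℂ} {z : ℂ}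

/-- The Cauchy transform `∮ f(t) w(t) / (t - z) dt` over the circle `C(c, R)`, without the usual
factor `1 / 2πi`. -/
noncomputable def cauchyTransform (c : ℂ) (R : ℝ) (w f : ℂ → ℂ) (z : ℂ) : ℂ :=
  ∮ t in C(c, R), f t / (t - z) * w t

/-- The integral over the circle `C(c, R)`, against the density `w`, of the divided difference
`(f(t) - f(z)) / (t - z)`; for entire `f` it is the entire part of the Cauchy transform of `f`. -/
noncomputable def slopeTransform (c : ℂ) (R : ℝ) (w f : ℂ → ℂ) (z : ℂ) : ℂ :=
  ∮ t in C(c, R), dslope f z t * w t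

theorem dslope_comm (f : ℂ → ℂ) (z t : ℂ) : dslope f z t = dslope f t z := by
  rcases eq_or_ne z t with rfl | h
  · rfl
  · rw [dslope_of_ne _ h.symm, dslope_of_ne _ h, slope_comm]

theorem differentiable_dslope (hf : Differentiable ℂ f) (z : ℂ) : Differentiable ℂ (dslope f z) :=
  differentiableOn_univ.1 ((Complex.differentiableOn_dslope univ_mem).2 hf.differentiableOn)

theorem norm_dslope_le_of_norm_deriv_le {s : Set ℂ} {B : ℝ} (hf : Differentiable ℂ f)
    (hs : Convex ℝ s) (hB : ∀ x ∈ s, ‖deriv f x‖ ≤ B) {t : ℂ} (hz : z ∈ s) (ht : t ∈ s) :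
    ‖dslope f z t‖ ≤ B := by
  rcases eq_or_ne t z with rfl | h
  · simpa using hB t ht
  · rw [dslope_of_ne _ h, slope_def_field, norm_div, div_le_iff₀ (norm_pos_iff.2 (sub_ne_zero.2 h))]
    exact hs.norm_image_sub_le_of_norm_deriv_le (fun x _ => hf x) hB hz ht

theorem exists_norm_dslope_le {s : Set ℂ} (hf : Differentiable ℂ f) (hs : Bornology.IsBounded s) :
    ∃ B, ∀ z ∈ s, ∀ t ∈ s, ‖dslope f z t‖ ≤ B := by
  obtain ⟨ρ, hρ⟩ := hs.subset_closedBall 0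
  obtain ⟨B, hB⟩ := (isCompact_closedBall (0 : ℂ) ρ).exists_bound_of_continuousOn
    hf.deriv.continuous.continuousOn
  exact ⟨B, fun z hz t ht =>
    norm_dslope_le_of_norm_deriv_le hf (convex_closedBall 0 ρ) hB (hρ hz) (hρ ht)⟩

theorem differentiable_slopeTransform (hw : CircleIntegrable w c R) (hf : Differentiable ℂ f) :
    Differentiable ℂ (slopeTransform c R w f) := by
  intro z₀
  obtain ⟨B, hB⟩ := exists_norm_dslope_le hf
    ((isBounded_ball (x := z₀) (r := 1)).union (isBounded_sphere (x := c) (r := |R|)))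
  refine (hasDerivAt_circleIntegral_mul (K := fun z t => dslope f z t) hw one_pos
    (fun z _ => (differentiable_dslope hf z).continuous.continuousOn) (fun t _ => ?_)
    fun z hz t ht => hB z (Or.inl hz) t (Or.inr ht)).differentiableAt
  simp only [dslope_comm f _ t]
  exact (differentiable_dslope hf t).differentiableOn

theorem sub_ne_zero_of_mem_of_notMem {s : Set ℂ} {t : ℂ} (ht : t ∈ s) (hz : z ∉ s) : t - z ≠ 0 :=
  sub_ne_zero.2 (ne_of_mem_of_not_mem ht hz)

theorem continuousOn_div_sub {s : Set ℂ} (hf : ContinuousOn f s) (hz : z ∉ s) :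
    ContinuousOn (fun t => f t / (t - z)) s :=
  hf.div (by fun_prop) fun _ ht => sub_ne_zero_of_mem_of_notMem ht hz

theorem circleIntegrable_mul (hR : 0 ≤ R) (hw : CircleIntegrable w c R)
    (hf : ContinuousOn f (sphere c R)) : CircleIntegrable (fun t => f t * w t) c R :=
  hw.continuousOn_mul (by rwa [abs_of_nonneg hR])

theorem cauchyTransform_mul_eq (hR : 0 ≤ R) (hw : CircleIntegrable w c R)
    (hf : ContinuousOn f (sphere c R)) (hg : ContinuousOn g (sphere c R)) (hz : z ∉ sphere c R) :
    cauchyTransform c R w (fun t => g t * f t) z =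
      slopeTransform c R (fun t => f t * w t) g z + g z * cauchyTransform c R w f z := by
  have hprod : CircleIntegrable (fun t => g t * f t / (t - z) * w t) c R :=
    circleIntegrable_mul hR hw (continuousOn_div_sub (hg.mul hf) hz)
  have hscaled : CircleIntegrable (fun t => g z * (f t / (t - z) * w t)) c R :=
    (circleIntegrable_mul hR hw (continuousOn_div_sub hf hz)).const_fun_smul (a := g z)
  rw [← sub_eq_iff_eq_add, cauchyTransform, cauchyTransform,
    ← circleIntegral.integral_const_mul, ← circleIntegral.integral_sub hprod hscaled]
  refine circleIntegral.integral_congr hR fun t ht => ?_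
  have hne := sub_ne_zero_of_mem_of_notMem ht hz
  simp only [dslope_of_ne g (sub_ne_zero.1 hne), slope_def_field]
  field_simp

theorem cauchyTransform_eq (hR : 0 ≤ R) (hw : CircleIntegrable w c R)
    (hf : ContinuousOn f (sphere c R)) (hz : z ∉ sphere c R) :
    cauchyTransform c R w f z = slopeTransform c R w f z + f z * cauchyTransform c R w 1 z := by
  simpa [Pi.one_def] using
    cauchyTransform_mul_eq hR hw continuousOn_const hf hz (f := fun _ => 1)

theorem hasDerivAt_cauchyTransform (hR : 0 ≤ R) (hw : CircleIntegrable w c R)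
    (hf : ContinuousOn f (sphere c R)) (hz : z ∉ sphere c R) :
    HasDerivAt (cauchyTransform c R w f) (∮ t in C(c, R), f t / (t - z) ^ 2 * w t) z := by
  rw [← abs_of_nonneg hR] at hf hz
  obtain ⟨B, hB⟩ := (isCompact_sphere c |R|).exists_bound_of_continuousOn hf
  obtain ⟨d, hd, hsep⟩ : ∃ d > 0, ∀ y ∈ ball z d, ∀ t ∈ sphere c |R|, d ≤ ‖t - y‖ := by
    obtain ⟨ε, hε, hball⟩ := Metric.isOpen_iff.1 isClosed_sphere.isOpen_compl z hz
    refine ⟨ε / 2, by positivity, fun y hy t ht => ?_⟩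
    have ht' : ε ≤ dist t z := by
      by_contra! hlt
      exact hball hlt ht
    rw [← dist_eq_norm]
    linarith [dist_triangle t y z, mem_ball.1 hy]
  have hne : ∀ y ∈ ball z d, ∀ t ∈ sphere c |R|, t - y ≠ 0 := fun y hy t ht =>
    norm_pos_iff.1 (hd.trans_le (hsep y hy t ht))
  have hkernel : ∀ y ∈ ball z d, ∀ t ∈ sphere c |R|,
      HasDerivAt (fun y => f t / (t - y)) (f t / (t - y) ^ 2) y := fun y hy t ht => by
    simpa [div_eq_mul_inv] using
      (((hasDerivAt_id y).const_sub t).inv (hne y hy t ht)).const_mul (f t)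
  refine (hasDerivAt_circleIntegral_mul (K := fun y t => f t / (t - y)) (B := B / d) hw hd
    (fun y hy => hf.div (by fun_prop) (hne y hy))
    (fun t ht y hy => (hkernel y hy t ht).differentiableAt.differentiableWithinAt)
    fun y hy t ht => ?_).congr_deriv ?_
  · rw [norm_div]
    exact div_le_div₀ ((norm_nonneg _).trans (hB t ht)) (hB t ht) hd (hsep y hy t ht)
  · refine circleIntegral.integral_congr hR fun t ht => ?_
    rw [(hkernel z (mem_ball_self hd) t (by rwa [abs_of_nonneg hR])).deriv]

theorem mul_cauchyTransform_sub_mul_cauchyTransform (hR : 0 ≤ R) (hw : CircleIntegrable w c R)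
    (hf : ContinuousOn f (sphere c R)) (hg : ContinuousOn g (sphere c R)) (hz : z ∉ sphere c R) :
    f z * cauchyTransform c R w g z - g z * cauchyTransform c R w f z =
      slopeTransform c R (fun t => f t * w t) g z -
        slopeTransform c R (fun t => g t * w t) f z := by
  have hfg := cauchyTransform_mul_eq hR hw hf hg hz
  have hgf := cauchyTransform_mul_eq hR hw hg hf hz
  simp only [mul_comm (f _) (g _)] at hgf
  linear_combination hfg - hgf

end CauchyTransform

section Pearson

open Metric

variable {c : ℂ} {R : ℝ} {A V w f g : ℂ → ℂ} {z : ℂ}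

/-- The Pearson equation `A w' = V w` for a density `w` on the circle `C(c, R)`, in weak form:
integration by parts against `w` produces no boundary term, so that `w` need not be differentiable,
nor even bounded, on the whole circle. -/
def IsPearson (c : ℂ) (R : ℝ) (A V w : ℂ → ℂ) : Prop :=
  ∀ f : ℂ → ℂ, AnalyticOnNhd ℂ f (sphere c R) →
    (∮ t in C(c, R), (deriv (fun t => A t * f t) t + V t * f t) * w t) = 0

theorem deriv_div_sub {t : ℂ} (hf : DifferentiableAt ℂ f t) (h : t ≠ z) :
    deriv (fun t => f t / (t - z)) t = deriv f t / (t - z) - f t / (t - z) ^ 2 := by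
  have hne := sub_ne_zero.2 h
  rw [(hf.hasDerivAt.fun_div ((hasDerivAt_id' t).sub_const z) hne).deriv]
  field_simp

theorem IsPearson.deriv_cauchyTransform (hP : IsPearson c R A V w) (hR : 0 ≤ R)
    (hw : CircleIntegrable w c R) (hA : Differentiable ℂ A) (hV : Continuous V)
    (hf : Differentiable ℂ f) (hz : z ∉ sphere c R) :
    deriv (cauchyTransform c R w fun t => A t * f t) z =
      cauchyTransform c R w (fun t => deriv (fun t => A t * f t) t + V t * f t) z := by
  have hAf : Differentiable ℂ fun t => A t * f t := hA.fun_mul hf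
  have hne : ∀ t ∈ sphere c R, t - z ≠ 0 := fun t ht => sub_ne_zero_of_mem_of_notMem ht hz
  have htest : AnalyticOnNhd ℂ (fun t => f t / (t - z)) (sphere c R) := fun t ht =>
    (hf.analyticAt t).div (by fun_prop) (hne t ht)
  have hint₁ : CircleIntegrable
      (fun t => (deriv (fun t => A t * f t) t + V t * f t) / (t - z) * w t) c R :=
    circleIntegrable_mul hR hw (continuousOn_div_sub
      (hAf.deriv.continuous.add (hV.mul hf.continuous)).continuousOn hz)
  have hint₂ : CircleIntegrable (fun t => A t * f t / (t - z) ^ 2 * w t) c R :=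
    circleIntegrable_mul hR hw (hAf.continuous.continuousOn.div (by fun_prop)
      fun t ht => pow_ne_zero 2 (hne t ht))
  rw [(hasDerivAt_cauchyTransform hR hw hAf.continuous.continuousOn hz).deriv, eq_comm,
    ← sub_eq_zero, cauchyTransform, ← circleIntegral.integral_sub hint₁ hint₂, ← hP _ htest]
  refine circleIntegral.integral_congr hR fun t ht => ?_
  simp only [← mul_div_assoc]
  rw [deriv_div_sub (hAf t) (sub_ne_zero.1 (hne t ht))]
  ring

theorem IsPearson.mul_deriv_cauchyTransform (hP : IsPearson c R A V w) (hR : 0 ≤ R)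
    (hw : CircleIntegrable w c R) (hA : Differentiable ℂ A) (hV : Continuous V)
    (hf : Differentiable ℂ f) (hz : z ∉ sphere c R) :
    A z * deriv (cauchyTransform c R w f) z =
      cauchyTransform c R w (fun t => deriv (fun t => A t * f t) t + V t * f t) z -
        deriv A z * cauchyTransform c R w f z -
        deriv (slopeTransform c R (fun t => f t * w t) A) z := by
  have hfw : CircleIntegrable (fun t => f t * w t) c R :=
    circleIntegrable_mul hR hw hf.continuous.continuousOn
  have hsplit : cauchyTransform c R w (fun t => A t * f t) =ᶠ[𝓝 z] fun z =>
      slopeTransform c R (fun t => f t * w t) A z + A z * cauchyTransform c R w f z := by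
    filter_upwards [isClosed_sphere.isOpen_compl.mem_nhds hz] with y hy
    exact cauchyTransform_mul_eq hR hw hf.continuous.continuousOn hA.continuous.continuousOn hy
  have hderiv := (differentiable_slopeTransform hfw hA z).hasDerivAt.fun_add
    ((hA z).hasDerivAt.fun_mul (hasDerivAt_cauchyTransform hR hw
      hf.continuous.continuousOn hz).differentiableAt.hasDerivAt)
  rw [← hP.deriv_cauchyTransform hR hw hA hV hf hz, hsplit.deriv_eq, hderiv.deriv]
  ring

/-- The entire continuation across the circle of the bilinear expression
`A (f' F_g - F_f' g) + (V / 2) (f F_g + F_f g)`, where `F_f` is the Cauchy transform of `f` against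
a density `w` with `A w' = V w`; see `pearsonForm_eq`. -/
noncomputable def pearsonForm (c : ℂ) (R : ℝ) (A V w f g : ℂ → ℂ) (z : ℂ) : ℂ :=
  A z * deriv f z * slopeTransform c R w g z
    - g z * slopeTransform c R w (fun t => deriv (fun t => A t * f t) t + V t * f t) z
    + g z * deriv A z * slopeTransform c R w f z
    + g z * deriv (slopeTransform c R (fun t => f t * w t) A) z
    + V z / 2 * (f z * slopeTransform c R w g z + g z * slopeTransform c R w f z)

theorem differentiable_pearsonForm (hR : 0 ≤ R) (hw : CircleIntegrable w c R)
    (hA : Differentiable ℂ A) (hV : Differentiable ℂ V) (hf : Differentiable ℂ f)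
    (hg : Differentiable ℂ g) : Differentiable ℂ (pearsonForm c R A V w f g) := by
  have hu : Differentiable ℂ fun t => deriv (fun t => A t * f t) t + V t * f t :=
    (hA.fun_mul hf).deriv.fun_add (hV.fun_mul hf)
  have hfw : CircleIntegrable (fun t => f t * w t) c R :=
    circleIntegrable_mul hR hw hf.continuous.continuousOn
  have hSf := differentiable_slopeTransform hw hf
  have hSg := differentiable_slopeTransform hw hg
  have hSu := differentiable_slopeTransform hw hu
  have hSA := (differentiable_slopeTransform hfw hA).deriv
  have := hA.deriv
  have := hf.deriv
  unfold pearsonForm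
  fun_prop

/-- All Cauchy transforms have the shape `F_f = S_f + f F_1` with `S_f` entire, and the Pearson
equation makes the coefficients of `F_1` cancel. -/
theorem IsPearson.pearsonForm_eq (hP : IsPearson c R A V w) (hR : 0 ≤ R)
    (hw : CircleIntegrable w c R) (hA : Differentiable ℂ A) (hV : Continuous V)
    (hf : Differentiable ℂ f) (hg : Differentiable ℂ g) (hz : z ∉ sphere c R) :
    pearsonForm c R A V w f g z =
      A z * (deriv f z * cauchyTransform c R w g z - deriv (cauchyTransform c R w f) z * g z) +
        V z / 2 * (f z * cauchyTransform c R w g z + cauchyTransform c R w f z * g z) := by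
  have hAf : deriv (fun t => A t * f t) z = deriv A z * f z + A z * deriv f z :=
    deriv_fun_mul (hA z) (hf z)
  have hFf := cauchyTransform_eq hR hw hf.continuous.continuousOn hz
  have hFg := cauchyTransform_eq hR hw hg.continuous.continuousOn hz
  have hu : Continuous fun t => deriv (fun t => A t * f t) t + V t * f t :=
    (hA.fun_mul hf).deriv.continuous.add (hV.mul hf.continuous)
  have hFu := cauchyTransform_eq hR hw hu.continuousOn hz
  have hF' := hP.mul_deriv_cauchyTransform hR hw hA hV hf hz
  rw [hFu, hAf] at hF'
  rw [hFf] at hF' ⊢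
  rw [hFg, pearsonForm]
  linear_combination g z * hF'

end Pearson

section MatrixFunctions

open Metric

variable {Y C : ℂ → Matrix (Fin 2) (Fin 2) ℂ} {z : ℂ}

/-- The third Pauli matrix. It governs the logarithmic derivative of the diagonal matrix `C_n`,
whose diagonal entries are inverse to each other. -/
def pauliZ : Matrix (Fin 2) (Fin 2) ℂ :=
  !![1, 0; 0, -1]

theorem matDeriv_mul (hY : ∀ i j, DifferentiableAt ℂ (fun z => Y z i j) z)
    (hC : ∀ i j, DifferentiableAt ℂ (fun z => C z i j) z) :
    matDeriv (fun z => Y z * C z) z = matDeriv Y z * C z + Y z * matDeriv C z := by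
  ext i j
  simp only [matDeriv, Matrix.of_apply, Matrix.add_apply, Matrix.mul_apply, Fin.sum_univ_two]
  rw [deriv_fun_add ((hY i 0).fun_mul (hC 0 j)) ((hY i 1).fun_mul (hC 1 j)),
    deriv_fun_mul (hY i 0) (hC 0 j), deriv_fun_mul (hY i 1) (hC 1 j)]
  ring

theorem matDeriv_mul_mul_inv {D : Matrix (Fin 2) (Fin 2) ℂ}
    (hY : ∀ i j, DifferentiableAt ℂ (fun z => Y z i j) z)
    (hC : ∀ i j, DifferentiableAt ℂ (fun z => C z i j) z) (hdet : IsUnit (C z).det)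
    (hC' : matDeriv C z = D * C z) :
    matDeriv (fun z => Y z * C z) z * (Y z * C z)⁻¹ = (matDeriv Y z + Y z * D) * (Y z)⁻¹ := by
  rw [matDeriv_mul hY hC, hC', ← mul_assoc (Y z), ← add_mul, Matrix.mul_inv_rev, mul_assoc,
    Matrix.mul_nonsing_inv_cancel_left _ _ hdet]

variable {c : ℂ} {R : ℝ} {A V w f g : ℂ → ℂ} {κ : ℂ}

/-- The matrix with rows `(f, F_f / 2πi)` and `κ (g, F_g / 2πi)`, where `F_f` is the Cauchy
transform of `f`; the matrix `Y_n` has this shape. -/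
noncomputable def cauchyMatrix (c : ℂ) (R : ℝ) (w f g : ℂ → ℂ) (κ z : ℂ) :
    Matrix (Fin 2) (Fin 2) ℂ :=
  !![f z, (2 * Real.pi * I)⁻¹ * cauchyTransform c R w f z;
     κ * g z, κ * ((2 * Real.pi * I)⁻¹ * cauchyTransform c R w g z)]

theorem det_cauchyMatrix (c : ℂ) (R : ℝ) (w f g : ℂ → ℂ) (κ z : ℂ) :
    (cauchyMatrix c R w f g κ z).det = κ * (2 * Real.pi * I)⁻¹ *
      (f z * cauchyTransform c R w g z - g z * cauchyTransform c R w f z) := by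
  rw [cauchyMatrix, Matrix.det_fin_two_of]
  ring

theorem differentiableAt_cauchyMatrix (hR : 0 ≤ R) (hw : CircleIntegrable w c R)
    (hf : Differentiable ℂ f) (hg : Differentiable ℂ g) (hz : z ∉ sphere c R) (i j : Fin 2) :
    DifferentiableAt ℂ (fun z => cauchyMatrix c R w f g κ z i j) z := by
  have hFf := (hasDerivAt_cauchyTransform hR hw hf.continuous.continuousOn hz).differentiableAt
  have hFg := (hasDerivAt_cauchyTransform hR hw hg.continuous.continuousOn hz).differentiableAt
  fin_cases i <;> fin_cases j
  · exact hf z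
  · exact hFf.const_mul _
  · exact (hg z).const_mul κ
  · exact (hFg.const_mul _).const_mul κ

theorem matDeriv_cauchyMatrix (c : ℂ) (R : ℝ) (w f g : ℂ → ℂ) (κ z : ℂ) :
    matDeriv (cauchyMatrix c R w f g κ) z =
      !![deriv f z, (2 * Real.pi * I)⁻¹ * deriv (cauchyTransform c R w f) z;
         κ * deriv g z, κ * ((2 * Real.pi * I)⁻¹ * deriv (cauchyTransform c R w g) z)] := by
  ext i j
  fin_cases i <;> fin_cases j <;> simp [matDeriv, cauchyMatrix]

/-- The entire continuation across the circle of `A Y' adj Y + (V / 2) Y σ₃ adj Y`, where `Y` is the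
matrix `cauchyMatrix c R w f g κ`; see `IsPearson.structureNumerator_eq`. -/
noncomputable def structureNumerator (c : ℂ) (R : ℝ) (A V w f g : ℂ → ℂ) (κ z : ℂ) :
    Matrix (Fin 2) (Fin 2) ℂ :=
  (2 * Real.pi * I)⁻¹ •
    !![κ * pearsonForm c R A V w f g z, -pearsonForm c R A V w f f z;
       κ ^ 2 * pearsonForm c R A V w g g z, -(κ * pearsonForm c R A V w g f z)]

theorem differentiable_structureNumerator (hR : 0 ≤ R) (hw : CircleIntegrable w c R)
    (hA : Differentiable ℂ A) (hV : Differentiable ℂ V) (hf : Differentiable ℂ f)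
    (hg : Differentiable ℂ g) (i j : Fin 2) :
    Differentiable ℂ fun z => structureNumerator c R A V w f g κ z i j := by
  fin_cases i <;> fin_cases j
  · exact ((differentiable_pearsonForm hR hw hA hV hf hg).const_mul κ).const_mul _
  · exact (differentiable_pearsonForm hR hw hA hV hf hf).fun_neg.const_mul _
  · exact ((differentiable_pearsonForm hR hw hA hV hg hg).const_mul (κ ^ 2)).const_mul _
  · exact ((differentiable_pearsonForm hR hw hA hV hg hf).const_mul κ).fun_neg.const_mul _

theorem IsPearson.structureNumerator_eq (hP : IsPearson c R A V w) (hR : 0 ≤ R)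
    (hw : CircleIntegrable w c R) (hA : Differentiable ℂ A) (hV : Continuous V)
    (hf : Differentiable ℂ f) (hg : Differentiable ℂ g) (hz : z ∉ sphere c R) :
    structureNumerator c R A V w f g κ z =
      A z • (matDeriv (cauchyMatrix c R w f g κ) z * (cauchyMatrix c R w f g κ z).adjugate) +
        (V z / 2) •
          (cauchyMatrix c R w f g κ z * pauliZ * (cauchyMatrix c R w f g κ z).adjugate) := by
  rw [matDeriv_cauchyMatrix, cauchyMatrix, pauliZ, structureNumerator,
    hP.pearsonForm_eq hR hw hA hV hf hg hz, hP.pearsonForm_eq hR hw hA hV hf hf hz,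
    hP.pearsonForm_eq hR hw hA hV hg hg hz, hP.pearsonForm_eq hR hw hA hV hg hf hz]
  ext i j
  fin_cases i <;> fin_cases j <;>
    simp [Matrix.adjugate_fin_two_of] <;> ring

theorem IsPearson.inv_smul_structureNumerator_eq (hP : IsPearson c R A V w) (hR : 0 ≤ R)
    (hw : CircleIntegrable w c R) (hA : Differentiable ℂ A) (hV : Continuous V)
    (hf : Differentiable ℂ f) (hg : Differentiable ℂ g) (hz : z ∉ sphere c R) (hAz : A z ≠ 0)
    (hdet : (cauchyMatrix c R w f g κ z).det = 1) :
    (A z)⁻¹ • structureNumerator c R A V w f g κ z =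
      (matDeriv (cauchyMatrix c R w f g κ) z +
          cauchyMatrix c R w f g κ z * ((V z / (2 * A z)) • pauliZ)) *
        (cauchyMatrix c R w f g κ z)⁻¹ := by
  have hscalar : (A z)⁻¹ * (V z / 2) = V z / (2 * A z) := by field_simp
  rw [hP.structureNumerator_eq hR hw hA hV hf hg hz, Matrix.inv_def, hdet, Ring.inverse_one,
    one_smul, smul_add, smul_smul, smul_smul, inv_mul_cancel₀ hAz, one_smul, hscalar, add_mul,
    Matrix.mul_smul, Matrix.smul_mul]

theorem IsPearson.structureNumerator_ne_zero (hP : IsPearson c R A V w) (hR : 0 ≤ R)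
    (hw : CircleIntegrable w c R) (hA : Differentiable ℂ A) (hV : Continuous V)
    (hf : Differentiable ℂ f) (hg : Differentiable ℂ g) (hz : z ∉ sphere c R) (hAz : A z = 0)
    (hVz : V z ≠ 0) (hdet : (cauchyMatrix c R w f g κ z).det ≠ 0) :
    structureNumerator c R A V w f g κ z ≠ 0 := by
  have hdetN : (structureNumerator c R A V w f g κ z).det =
      -(V z / 2 * (cauchyMatrix c R w f g κ z).det) ^ 2 := by
    rw [hP.structureNumerator_eq hR hw hA hV hf hg hz, hAz, zero_smul, zero_add, Matrix.det_smul,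
      Matrix.det_mul, Matrix.det_mul, Matrix.det_adjugate, pauliZ, Matrix.det_fin_two_of,
      Fintype.card_fin]
    ring
  have hne : -(V z / 2 * (cauchyMatrix c R w f g κ z).det) ^ 2 ≠ 0 :=
    neg_ne_zero.2 (pow_ne_zero 2 (mul_ne_zero (div_ne_zero hVz two_ne_zero) hdet))
  intro hN
  rw [hN, Matrix.det_zero] at hdetN
  exact hne hdetN.symm

end MatrixFunctions

section Orthogonality

open Metric

theorem eval_divByMonic_X_sub_C {K : Type*} [Field K] (P : K[X]) {z t : K} (h : t ≠ z) :
    (P /ₘ (X - Polynomial.C z)).eval t = slope (fun x => P.eval x) z t := by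
  have hdiv := congrArg (eval t) (X_sub_C_mul_divByMonic_eq_sub_modByMonic P z)
  rw [modByMonic_X_sub_C_eq_C_eval] at hdiv
  simp only [eval_mul, eval_sub, eval_X, eval_C] at hdiv
  rw [slope_def_field, ← hdiv, mul_div_cancel_left₀ _ (sub_ne_zero.2 h)]

theorem slopeTransform_eval {c : ℂ} {R : ℝ} (hR : 0 ≤ R) (w : ℂ → ℂ) (P : ℂ[X]) {z : ℂ}
    (hz : z ∉ sphere c R) :
    slopeTransform c R w (fun t => P.eval t) z =
      ∮ t in C(c, R), (P /ₘ (X - Polynomial.C z)).eval t * w t := by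
  refine circleIntegral.integral_congr hR fun t ht => ?_
  have hne : t ≠ z := ne_of_mem_of_not_mem ht hz
  simp only [eval_divByMonic_X_sub_C P hne, dslope_of_ne _ hne]

theorem map_eq_zero_of_degree_lt {R R' M : Type*} [CommRing R] [CommRing R'] [AddCommGroup M]
    [Module R' M] {σ : R →+* R'} (L : R[X] →ₛₗ[σ] M) (S : Polynomial.Sequence R) {n : ℕ}
    (hS : ∀ k < n, IsUnit (S k).leadingCoeff) (hL : ∀ k < n, L (S k) = 0) {Q : R[X]}
    (hQ : Q.degree < n) : L Q = 0 := by
  have hspan : Q ∈ Submodule.span R (S '' Set.Iio n) := by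
    rwa [S.span_degreeLT hS, mem_degreeLT]
  refine LinearMap.eqOn_span (f := L) (g := 0) ?_ hspan
  rintro _ ⟨k, hk, rfl⟩
  exact hL k hk

theorem natDegree_recip_le {P : ℂ[X]} {k : ℕ} (hP : P.natDegree ≤ k) :
    (recip k P).natDegree ≤ k :=
  natDegree_reflect_le.trans (max_le le_rfl (natDegree_map_le.trans hP))

theorem recip_recip (k : ℕ) (P : ℂ[X]) : recip k (recip k P) = P := by
  ext j
  simp [recip]

theorem recip_eval {P : ℂ[X]} {k : ℕ} (hP : P.natDegree ≤ k) {t : ℂ} (ht : ‖t‖ = 1) :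
    (recip k P).eval t = conj (P.eval t) * t ^ k := by
  have ht₀ : t ≠ 0 := norm_ne_zero_iff.1 (ht ▸ one_ne_zero)
  let := invertibleOfNonzero (inv_ne_zero ht₀)
  have hreflect := eval₂_reflect_mul_pow (RingHom.id ℂ) t⁻¹ k (P.map (starRingEnd ℂ))
    (natDegree_map_le.trans hP)
  rw [invOf_eq_inv, inv_inv, inv_pow, eval₂_id, eval₂_id, RCLike.inv_eq_conj ht, eval_map,
    eval₂_at_apply] at hreflect
  rw [recip, ← hreflect, inv_mul_cancel_right₀ (pow_ne_zero k ht₀)]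

variable {ν : ℂ → ℂ} {Φ Ψ : ℕ → ℂ[X]} {h : ℕ → ℂ}

theorem circleIntegrable_pairing (hν : CircleIntegrable ν 0 1) (P Q : ℂ[X]) :
    CircleIntegrable (fun t => P.eval t * conj (Q.eval t) * (ν t / (I * t))) 0 1 := by
  have hne : ∀ t ∈ sphere (0 : ℂ) 1, I * t ≠ 0 := fun t ht =>
    mul_ne_zero I_ne_zero (ne_zero_of_mem_unit_sphere ⟨t, ht⟩)
  have hcont : ContinuousOn (fun t => P.eval t * conj (Q.eval t) / (I * t)) (sphere 0 1) :=
    ((P.continuous.mul (continuous_conj.comp Q.continuous)).continuousOn).div (by fun_prop) hne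
  refine (circleIntegrable_mul zero_le_one hν hcont).congr_codiscreteWithin ?_
  exact Eventually.of_forall fun t => by ring

/-- The sesquilinear pairing `(P, Q) ↦ ∮ P(z) conj(Q(z)) ν(z) / (iz) dz` of polynomials. -/
noncomputable def circlePairing (hν : CircleIntegrable ν 0 1) :
    ℂ[X] →ₗ[ℂ] ℂ[X] →ₛₗ[starRingEnd ℂ] ℂ :=
  LinearMap.mk₂'ₛₗ (RingHom.id ℂ) (starRingEnd ℂ)
    (fun P Q => ∮ z in C(0, 1), P.eval z * conj (Q.eval z) * (ν z / (I * z)))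
    (fun P₁ P₂ Q => by
      simp only [eval_add, add_mul]
      exact circleIntegral.integral_add (circleIntegrable_pairing hν P₁ Q)
        (circleIntegrable_pairing hν P₂ Q))
    (fun a P Q => by
      simp only [eval_smul, smul_eq_mul, RingHom.id_apply, mul_assoc]
      exact circleIntegral.integral_const_mul _ _ _ _)
    (fun P Q₁ Q₂ => by
      simp only [eval_add, map_add, mul_add, add_mul]
      exact circleIntegral.integral_add (circleIntegrable_pairing hν P Q₁)
        (circleIntegrable_pairing hν P Q₂))
    (fun a P Q => by
      simp only [eval_smul, smul_eq_mul, map_mul, mul_left_comm _ (conj a), mul_assoc]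
      exact circleIntegral.integral_const_mul _ _ _ _)

theorem circlePairing_apply (hν : CircleIntegrable ν 0 1) (P Q : ℂ[X]) :
    circlePairing hν P Q = ∮ z in C(0, 1), P.eval z * conj (Q.eval z) * (ν z / (I * z)) := rfl

theorem integral_eval_mul_eval_recip (hν : CircleIntegrable ν 0 1) (P : ℂ[X]) {Q : ℂ[X]} {m : ℕ}
    (hQ : Q.natDegree ≤ m) :
    (∮ t in C(0, 1), P.eval t * ((recip m Q).eval t * (ν t / t ^ (m + 1)))) =
      I * circlePairing hν P Q := by
  rw [circlePairing_apply, ← circleIntegral.integral_const_mul]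
  refine circleIntegral.integral_congr zero_le_one fun t ht => ?_
  have ht₀ : t ≠ 0 := ne_zero_of_mem_unit_sphere ⟨t, ht⟩
  simp only [recip_eval hQ (mem_sphere_zero_iff_norm.1 ht)]
  field_simp
  ring

/-- The left polynomials as a graded basis of `ℂ[X]`. -/
noncomputable def IsBiorthogonal.leftSequence (hΦ : IsBiorthogonal ν Φ Ψ h) :
    Polynomial.Sequence ℂ :=
  ⟨Φ, fun k => by rw [degree_eq_natDegree (hΦ.monic_left k).ne_zero, hΦ.degree_left]⟩

/-- The right polynomials as a graded basis of `ℂ[X]`. -/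
noncomputable def IsBiorthogonal.rightSequence (hΦ : IsBiorthogonal ν Φ Ψ h) :
    Polynomial.Sequence ℂ :=
  ⟨Ψ, fun k => by rw [degree_eq_natDegree (hΦ.monic_right k).ne_zero, hΦ.degree_right]⟩

theorem IsBiorthogonal.circlePairing_left_eq_zero (hΦ : IsBiorthogonal ν Φ Ψ h)
    (hν : CircleIntegrable ν 0 1) {n : ℕ} {Q : ℂ[X]} (hQ : Q.degree < n) :
    circlePairing hν (Φ n) Q = 0 := by
  refine map_eq_zero_of_degree_lt (circlePairing hν (Φ n)) hΦ.rightSequence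
    (fun k _ => ((hΦ.monic_right k).leadingCoeff ▸ isUnit_one)) (fun k hk => ?_) hQ
  exact (hΦ.orthogonal n k).trans (if_neg hk.ne')

theorem IsBiorthogonal.circlePairing_right_eq (hΦ : IsBiorthogonal ν Φ Ψ h)
    (hν : CircleIntegrable ν 0 1) {n : ℕ} {P : ℂ[X]} (hP : P.Monic) (hdeg : P.natDegree = n) :
    circlePairing hν P (Ψ n) = h n := by
  have hdegP : P.degree = n := by rw [degree_eq_natDegree hP.ne_zero, hdeg]
  have hlt : (P - Φ n).degree < n := by
    rw [← hdegP]
    exact degree_sub_lt_left (hdegP.trans (hΦ.leftSequence.degree_eq n).symm) hP.ne_zero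
      (hP.leadingCoeff.trans (hΦ.monic_left n).leadingCoeff.symm)
  have hzero : (circlePairing hν).flip (Ψ n) (P - Φ n) = 0 := by
    refine map_eq_zero_of_degree_lt _ hΦ.leftSequence
      (fun k _ => ((hΦ.monic_left k).leadingCoeff ▸ isUnit_one)) (fun k hk => ?_) hlt
    exact (hΦ.orthogonal k n).trans (if_neg hk.ne)
  rw [map_sub, sub_eq_zero] at hzero
  exact hzero.trans ((hΦ.orthogonal n n).trans (if_pos rfl))

theorem IsBiorthogonal.slopeTransform_recip_eq_zero (hΦ : IsBiorthogonal ν Φ Ψ h)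
    (hν : CircleIntegrable ν 0 1) (m : ℕ) {z : ℂ} (hz : z ∉ sphere (0 : ℂ) 1) :
    slopeTransform 0 1 (fun t => (Φ (m + 1)).eval t * (ν t / t ^ (m + 1)))
      (fun t => (recip m (Ψ m)).eval t) z = 0 := by
  set Q := recip m (Ψ m) /ₘ (X - Polynomial.C z) with hQdef
  have hQ : Q.natDegree ≤ m := by
    rw [hQdef, natDegree_divByMonic _ (monic_X_sub_C z)]
    exact (Nat.sub_le _ _).trans (natDegree_recip_le (hΦ.degree_right m).le)
  have hdeg : (recip m Q).degree < (m + 1 : ℕ) :=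
    (degree_le_of_natDegree_le (natDegree_recip_le hQ)).trans_lt (by exact_mod_cast m.lt_succ_self)
  have hint := integral_eval_mul_eval_recip hν (Φ (m + 1)) (natDegree_recip_le hQ)
  rw [recip_recip, hΦ.circlePairing_left_eq_zero hν hdeg, mul_zero] at hint
  rw [slopeTransform_eval zero_le_one _ _ hz]
  simpa only [mul_left_comm] using hint

theorem IsBiorthogonal.slopeTransform_left_eq (hΦ : IsBiorthogonal ν Φ Ψ h)
    (hν : CircleIntegrable ν 0 1) (m : ℕ) {z : ℂ} (hz : z ∉ sphere (0 : ℂ) 1) :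
    slopeTransform 0 1 (fun t => (recip m (Ψ m)).eval t * (ν t / t ^ (m + 1)))
      (fun t => (Φ (m + 1)).eval t) z = I * h m := by
  have hdeg : 0 < (Φ (m + 1)).natDegree := by rw [hΦ.degree_left]; exact m.succ_pos
  have hmonic : (Φ (m + 1) /ₘ (X - Polynomial.C z)).Monic := by
    rw [Monic, leadingCoeff_divByMonic_X_sub_C _ (natDegree_pos_iff_degree_pos.1 hdeg).ne' z]
    exact hΦ.monic_left (m + 1)
  have hnat : (Φ (m + 1) /ₘ (X - Polynomial.C z)).natDegree = m := by
    rw [natDegree_divByMonic _ (monic_X_sub_C z), natDegree_X_sub_C, hΦ.degree_left]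
    exact Nat.add_sub_cancel m 1
  rw [slopeTransform_eval zero_le_one _ _ hz,
    integral_eval_mul_eval_recip hν _ (hΦ.degree_right m).le,
    hΦ.circlePairing_right_eq hν hmonic hnat]

theorem Ymat_succ (ν : ℂ → ℂ) (Φ Ψ : ℕ → ℂ[X]) (h : ℕ → ℂ) (m : ℕ) :
    Ymat ν Φ Ψ h (m + 1) = cauchyMatrix 0 1 (fun t => ν t / t ^ (m + 1))
      (fun t => (Φ (m + 1)).eval t) (fun t => (recip m (Ψ m)).eval t) (-(2 * Real.pi / h m)) :=
  rfl

theorem circleIntegrable_div_pow (hν : CircleIntegrable ν 0 1) (n : ℕ) :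
    CircleIntegrable (fun t => ν t / t ^ n) 0 1 := by
  have hcont : ContinuousOn (fun t : ℂ => (t ^ n)⁻¹) (sphere 0 1) :=
    (continuousOn_id.pow n).inv₀ fun t ht => pow_ne_zero n (ne_zero_of_mem_unit_sphere ⟨t, ht⟩)
  refine (circleIntegrable_mul zero_le_one hν hcont).congr_codiscreteWithin ?_
  exact Eventually.of_forall fun t => by ring

theorem IsBiorthogonal.det_Ymat (hΦ : IsBiorthogonal ν Φ Ψ h) (hν : CircleIntegrable ν 0 1)
    (m : ℕ) {z : ℂ} (hz : z ∉ sphere (0 : ℂ) 1) : (Ymat ν Φ Ψ h (m + 1) z).det = 1 := by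
  have hm := hΦ.norm_ne_zero m
  have hwronskian := mul_cauchyTransform_sub_mul_cauchyTransform zero_le_one
    (circleIntegrable_div_pow hν (m + 1)) (Φ (m + 1)).continuousOn (recip m (Ψ m)).continuousOn hz
  rw [hΦ.slopeTransform_recip_eq_zero hν m hz, hΦ.slopeTransform_left_eq hν m hz] at hwronskian
  rw [Ymat_succ, det_cauchyMatrix, hwronskian]
  field_simp
  ring

end Orthogonality

section Weight

open MeasureTheory Metric

theorem IsPearson.mul_analytic {c : ℂ} {R : ℝ} {A V w G m : ℂ → ℂ} (hP : IsPearson c R A V w)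
    (hR : 0 ≤ R) (hA : Differentiable ℂ A) (hm : AnalyticOnNhd ℂ m (sphere c R))
    (hG : ∀ t ∈ sphere c R, A t * deriv m t = G t * m t) :
    IsPearson c R A (fun t => V t + G t) fun t => m t * w t := by
  intro f hf
  refine Eq.trans (circleIntegral.integral_congr hR fun t ht => ?_) (hP _ (hf.mul hm))
  have hAf : DifferentiableAt ℂ (fun t => A t * f t) t :=
    (hA t).fun_mul (hf t ht).differentiableAt
  simp only [← mul_assoc]
  rw [deriv_fun_mul hAf (hm t ht).differentiableAt]
  linear_combination -f t * w t * hG t ht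

theorem norm_one_sub_circleMap (θ : ℝ) : ‖1 - circleMap 0 1 θ‖ = 2 * |Real.sin (θ / 2)| := by
  rw [norm_sub_rev, circleMap_zero, ofReal_one, one_mul, mul_comm,
    norm_exp_I_mul_ofReal_sub_one, norm_mul, Real.norm_two, Real.norm_eq_abs]

theorem mul_abs_le_norm_one_sub_circleMap {θ : ℝ} (hθ : |θ| ≤ Real.pi) :
    2 / Real.pi * |θ| ≤ ‖1 - circleMap 0 1 θ‖ := by
  have hhalf : |θ / 2| = |θ| / 2 := by rw [abs_div, abs_two]
  have hsin := Real.mul_abs_le_abs_sin (x := θ / 2) (by linarith)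
  rw [norm_one_sub_circleMap]
  linarith [hhalf ▸ hsin]

theorem rpow_le_rpow_add_rpow {δ x M : ℝ} (hδ : 0 < δ) (hx : δ ≤ x) (hM : x ≤ M) (s : ℝ) :
    x ^ s ≤ M ^ s + δ ^ s := by
  have hxM : 0 ≤ M := (hδ.le.trans hx).trans hM
  rcases le_total 0 s with hs | hs
  · exact (Real.rpow_le_rpow (hδ.le.trans hx) hM hs).trans
      (le_add_of_nonneg_right (Real.rpow_nonneg hδ.le s))
  · exact (Real.rpow_le_rpow_of_nonpos hδ hx hs).trans
      (le_add_of_nonneg_left (Real.rpow_nonneg hxM s))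

theorem norm_cpow_le_rpow_mul_exp (z s : ℂ) :
    ‖z ^ s‖ ≤ ‖z‖ ^ s.re * Real.exp (Real.pi * |s.im|) := by
  refine (norm_cpow_le z s).trans ?_
  rw [div_eq_mul_inv, ← Real.exp_neg]
  gcongr
  calc -(z.arg * s.im) ≤ |z.arg * s.im| := neg_le_abs _
    _ ≤ Real.pi * |s.im| := by
      rw [abs_mul]
      exact mul_le_mul_of_nonneg_right (abs_arg_le_pi z) (abs_nonneg _)

theorem norm_one_sub_circleMap_cpow_le {θ : ℝ} (hθ : |θ| ≤ Real.pi) (hne : θ ≠ 0) (s : ℂ) :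
    ‖(1 - circleMap 0 1 θ) ^ s‖ ≤
      (2 ^ s.re + (2 / Real.pi) ^ s.re * |θ| ^ s.re) * Real.exp (Real.pi * |s.im|) := by
  have hpos : 0 < 2 / Real.pi * |θ| := mul_pos (div_pos two_pos Real.pi_pos) (abs_pos.2 hne)
  have hle : ‖1 - circleMap 0 1 θ‖ ≤ 2 := by
    rw [norm_one_sub_circleMap]
    linarith [Real.abs_sin_le_one (θ / 2)]
  refine (norm_cpow_le_rpow_mul_exp _ s).trans ?_
  gcongr
  rw [← Real.mul_rpow (div_pos two_pos Real.pi_pos).le (abs_nonneg θ)]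
  exact rpow_le_rpow_add_rpow hpos (mul_abs_le_norm_one_sub_circleMap hθ) hle _

theorem intervalIntegrable_abs_rpow {s : ℝ} (hs : -1 < s) (a b : ℝ) :
    IntervalIntegrable (fun x : ℝ => |x| ^ s) volume a b := by
  have hcpow := (intervalIntegral.intervalIntegrable_cpow' (a := a) (b := b) (r := s)
    (by rwa [ofReal_re])).norm
  simpa only [norm_cpow_real, norm_real, Real.norm_eq_abs] using hcpow

theorem intervalIntegrable_one_sub_circleMap_cpow {s : ℂ} (hs : -1 < s.re) (a b : ℝ) :
    IntervalIntegrable (fun θ : ℝ => (1 - circleMap 0 1 θ) ^ s) volume a b := by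
  have hper : Function.Periodic (fun θ : ℝ => (1 - circleMap 0 1 θ) ^ s) (2 * Real.pi) :=
    fun θ => by simp only [periodic_circleMap 0 1 θ]
  have hmeas : Measurable fun θ : ℝ => (1 - circleMap 0 1 θ) ^ s := by fun_prop
  refine hper.intervalIntegrable Real.two_pi_pos.ne' (t := -Real.pi) ?_ a b
  rw [show -Real.pi + 2 * Real.pi = Real.pi by ring]
  have hbound := ((intervalIntegrable_const (c := (2 : ℝ) ^ s.re)).add
    ((intervalIntegrable_abs_rpow hs (-Real.pi) Real.pi).const_mul
      ((2 / Real.pi) ^ s.re))).mul_const (Real.exp (Real.pi * |s.im|))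
  refine hbound.mono_fun' hmeas.aestronglyMeasurable ?_
  rw [Filter.EventuallyLE, ae_restrict_iff' measurableSet_uIoc]
  filter_upwards [Measure.ae_ne volume 0] with θ hne hθ
  rw [Set.uIoc_of_le (by linarith [Real.pi_pos])] at hθ
  exact norm_one_sub_circleMap_cpow_le (abs_le.2 ⟨hθ.1.le, hθ.2⟩) hne s

/-- The power density `(-z)^a (1-z)^s` with principal powers: the weight `jacobiWeight` without its
entire factor. -/
noncomputable def powerDensity (a s z : ℂ) : ℂ :=
  (-z) ^ a * (1 - z) ^ s

theorem neg_circleMap_cpow {θ : ℝ} (hθ : θ ∈ Set.Ioc 0 (2 * Real.pi)) (a : ℂ) :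
    (-circleMap 0 1 θ) ^ a = exp ((θ - Real.pi) * I * a) := by
  have hexp : -circleMap 0 1 θ = exp ((θ - Real.pi) * I) := by
    rw [sub_mul, exp_sub, exp_pi_mul_I, circleMap_zero, ofReal_one, one_mul, div_neg, div_one]
  have him : ((θ - Real.pi) * I : ℂ).im = θ - Real.pi := by simp
  rw [hexp, cpow_def_of_ne_zero (exp_ne_zero _), log_exp]
  · linarith [hθ.1]
  · linarith [hθ.2]

theorem powerDensity_circleMap {θ : ℝ} (hθ : θ ∈ Set.Ioc 0 (2 * Real.pi)) (a s : ℂ) :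
    powerDensity a s (circleMap 0 1 θ) =
      exp ((θ - Real.pi) * I * a) * (1 - circleMap 0 1 θ) ^ s := by
  rw [powerDensity, neg_circleMap_cpow hθ]

theorem circleIntegrable_powerDensity (a : ℂ) {s : ℂ} (hs : -1 < s.re) :
    CircleIntegrable (powerDensity a s) 0 1 := by
  have hcont : Continuous fun θ : ℝ => exp ((θ - Real.pi) * I * a) := by fun_prop
  refine ((intervalIntegrable_one_sub_circleMap_cpow hs 0 (2 * Real.pi)).continuousOn_mul
    hcont.continuousOn).congr fun θ hθ => ?_
  rw [Set.uIoc_of_le Real.two_pi_pos.le] at hθ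
  exact (powerDensity_circleMap hθ a s).symm

theorem one_sub_circleMap_re (θ : ℝ) : (1 - circleMap 0 1 θ).re = 1 - Real.cos θ := by
  simp [circleMap, exp_ofReal_mul_I_re]

theorem one_sub_circleMap_mem_slitPlane {θ : ℝ} (hθ : θ ∈ Set.Ioo 0 (2 * Real.pi)) :
    1 - circleMap 0 1 θ ∈ slitPlane := by
  have hcos : Real.cos θ ≠ 1 := fun h => hθ.1.ne'
    ((Real.cos_eq_one_iff_of_lt_of_lt (by linarith [hθ.1, hθ.2]) hθ.2).1 h)
  refine mem_slitPlane_iff.2 (Or.inl ?_)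
  rw [one_sub_circleMap_re]
  exact sub_pos.2 (lt_of_le_of_ne (Real.cos_le_one θ) hcos)

theorem continuous_one_sub_circleMap_cpow {s : ℂ} (hs : 0 < s.re) :
    Continuous fun θ : ℝ => (1 - circleMap 0 1 θ) ^ s := by
  refine continuous_iff_continuousAt.2 fun θ => ?_
  have hre : 0 ≤ (1 - circleMap 0 1 θ).re := by
    rw [one_sub_circleMap_re]
    exact sub_nonneg.2 (Real.cos_le_one θ)
  exact (continuousAt_cpow_const_of_re_pos (Or.inl hre) hs).comp
    (f := fun θ : ℝ => 1 - circleMap 0 1 θ) (by fun_prop)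

theorem hasDerivAt_exp_mul_one_sub_circleMap_cpow_mul {a s : ℂ} {f : ℂ → ℂ} {θ : ℝ}
    (hθ : θ ∈ Set.Ioo 0 (2 * Real.pi)) (hf : DifferentiableAt ℂ f (circleMap 0 1 θ)) :
    HasDerivAt (fun θ : ℝ => exp ((θ - Real.pi) * I * a) * (1 - circleMap 0 1 θ) ^ (s + 1) *
        (circleMap 0 1 θ * f (circleMap 0 1 θ)))
      (deriv (circleMap 0 1) θ • ((deriv (fun t => t * (1 - t) * f t) (circleMap 0 1 θ) +
        (a * (1 - circleMap 0 1 θ) - s * circleMap 0 1 θ) * f (circleMap 0 1 θ)) *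
          powerDensity a s (circleMap 0 1 θ))) θ := by
  have hslit := one_sub_circleMap_mem_slitPlane hθ
  have hcircle := hasDerivAt_circleMap 0 1 θ
  have hexp : HasDerivAt (fun θ : ℝ => exp ((θ - Real.pi) * I * a))
      (exp ((θ - Real.pi) * I * a) * (I * a)) θ := by
    simpa using ((((hasDerivAt_id θ).ofReal_comp.sub_const (Real.pi : ℂ)).mul_const I).mul_const
      a).cexp
  have hpow : HasDerivAt (fun θ : ℝ => (1 - circleMap 0 1 θ) ^ (s + 1))
      (-(circleMap 0 1 θ * I) * ((s + 1) * (1 - circleMap 0 1 θ) ^ s)) θ := by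
    have hcpow := (hasDerivAt_id (1 - circleMap 0 1 θ)).cpow_const (c := s + 1) hslit
    simpa [Function.comp_def] using hcpow.scomp θ (hcircle.const_sub 1)
  have hprod : HasDerivAt (fun t => t * (1 - t) * f t)
      ((1 - 2 * circleMap 0 1 θ) * f (circleMap 0 1 θ) +
        circleMap 0 1 θ * (1 - circleMap 0 1 θ) * deriv f (circleMap 0 1 θ)) (circleMap 0 1 θ) := by
    refine (((hasDerivAt_id' _).fun_mul ((hasDerivAt_id' _).const_sub 1)).fun_mul
      hf.hasDerivAt).congr_deriv ?_
    ring
  refine ((hexp.fun_mul hpow).fun_mul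
    (hcircle.fun_mul (hf.hasDerivAt.scomp θ hcircle))).congr_deriv ?_
  rw [hprod.deriv, powerDensity_circleMap (Set.Ioo_subset_Ioc_self hθ), deriv_circleMap,
    cpow_add _ _ (slitPlane_ne_zero hslit), cpow_one]
  simp only [smul_eq_mul, Function.comp_apply]
  ring

theorem isPearson_powerDensity (a : ℂ) {s : ℂ} (hs : -1 < s.re) :
    IsPearson 0 1 (fun t => t * (1 - t)) (fun t => a * (1 - t) - s * t) (powerDensity a s) := by
  intro f hf
  have hs' : 0 < (s + 1).re := by
    rw [add_re, one_re]
    linarith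
  have hs₀ : s + 1 ≠ 0 := fun h => hs'.ne' (by rw [h, zero_re])
  have hsphere : ∀ θ : ℝ, circleMap 0 1 θ ∈ sphere (0 : ℂ) 1 :=
    circleMap_mem_sphere 0 zero_le_one
  have hcont : Continuous fun θ : ℝ => exp ((θ - Real.pi) * I * a) *
      (1 - circleMap 0 1 θ) ^ (s + 1) * (circleMap 0 1 θ * f (circleMap 0 1 θ)) :=
    ((by fun_prop : Continuous fun θ : ℝ => exp ((θ - Real.pi) * I * a)).mul
      (continuous_one_sub_circleMap_cpow hs')).mul ((continuous_circleMap 0 1).mul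
        (hf.continuousOn.comp_continuous (continuous_circleMap 0 1) hsphere))
  have hAf : AnalyticOnNhd ℂ (fun t => t * (1 - t) * f t) (sphere 0 1) := fun t ht =>
    ((by fun_prop : Differentiable ℂ fun t : ℂ => t * (1 - t)).analyticAt t).mul (hf t ht)
  have hint := circleIntegrable_mul zero_le_one (circleIntegrable_powerDensity a hs)
    (hAf.deriv.continuousOn.add
      ((by fun_prop : Continuous fun t => a * (1 - t) - s * t).continuousOn.mul hf.continuousOn))
  rw [circleIntegral, intervalIntegral.integral_eq_sub_of_hasDerivAt_of_le Real.two_pi_pos.le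
    hcont.continuousOn (fun θ hθ => hasDerivAt_exp_mul_one_sub_circleMap_cpow_mul hθ
      (hf _ (hsphere θ)).differentiableAt) hint.out]
  simp [circleMap, hs₀]

variable {b : ℂ} {H G : ℂ → ℂ}

theorem neg_one_lt_add_conj_re (hb : -1 / 2 < b.re) : -1 < (b + conj b).re := by
  rw [add_re, conj_re]
  linarith

theorem jacobiWeight_eq (b : ℂ) (H : ℂ → ℂ) :
    jacobiWeight b H = fun z => H z * powerDensity (-conj b) (b + conj b) z :=
  funext fun _ => mul_comm _ _

theorem circleIntegrable_jacobiWeight (hb : -1 / 2 < b.re) (hH : Continuous H) :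
    CircleIntegrable (jacobiWeight b H) 0 1 := by
  rw [jacobiWeight_eq]
  exact circleIntegrable_mul zero_le_one
    (circleIntegrable_powerDensity _ (neg_one_lt_add_conj_re hb)) hH.continuousOn

/-- The coefficient `V` of the Pearson equation `z (1 - z) w' = V w` of the density
`w(z) = ν(z) / z^n`, where `G = z (1 - z) H' / H`. -/
noncomputable def jacobiPearsonCoeff (b : ℂ) (G : ℂ → ℂ) (n : ℕ) (z : ℂ) : ℂ :=
  -conj b * (1 - z) - (b + conj b) * z + (G z - n * (1 - z))

theorem mul_deriv_div_pow (hH : Differentiable ℂ H)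
    (hG : ∀ z, z * (1 - z) * deriv H z = G z * H z) (n : ℕ) {z : ℂ} (hz : z ≠ 0) :
    z * (1 - z) * deriv (fun t => H t / t ^ n) z = (G z - n * (1 - z)) * (H z / z ^ n) := by
  have hderiv := ((hH z).hasDerivAt.fun_mul (hasDerivAt_zpow (-n) z (Or.inl hz))).deriv
  have hfun : (fun t => H t / t ^ n) = fun t => H t * t ^ (-n : ℤ) :=
    funext fun t => by rw [zpow_neg, zpow_natCast, div_eq_mul_inv]
  rw [hfun, hderiv, zpow_sub_one₀ hz, zpow_neg, zpow_natCast]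
  push_cast
  field_simp
  linear_combination hG z

theorem isPearson_jacobiWeight_div_pow (hb : -1 / 2 < b.re) (hH : Differentiable ℂ H)
    (hG : ∀ z, z * (1 - z) * deriv H z = G z * H z) (n : ℕ) :
    IsPearson 0 1 (fun t => t * (1 - t)) (jacobiPearsonCoeff b G n)
      fun t => jacobiWeight b H t / t ^ n := by
  have hne : ∀ t ∈ sphere (0 : ℂ) 1, t ≠ 0 := fun t ht => ne_zero_of_mem_unit_sphere ⟨t, ht⟩
  have hw : (fun t => jacobiWeight b H t / t ^ n) =
      fun t => H t / t ^ n * powerDensity (-conj b) (b + conj b) t :=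
    funext fun t => by rw [jacobiWeight_eq]; ring
  rw [hw]
  exact (isPearson_powerDensity (-conj b) (neg_one_lt_add_conj_re hb)).mul_analytic
    zero_le_one (by fun_prop)
    (fun t ht => (hH.analyticAt t).div (by fun_prop) (pow_ne_zero n (hne t ht)))
    fun t ht => mul_deriv_div_pow hH hG n (hne t ht)

end Weight

section Factorization

theorem exists_eq_pow_mul_of_differentiable {f : ℂ → ℂ} (hf : Differentiable ℂ f) (hne : f ≠ 0)
    (c : ℂ) : ∃ (p : ℕ) (g : ℂ → ℂ), Differentiable ℂ g ∧ g c ≠ 0 ∧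
      ∀ z, f z = (z - c) ^ p * g z := by
  obtain ⟨q, hq⟩ := hf.analyticAt c
  have hq0 : q ≠ 0 := fun h => hne <| AnalyticOnNhd.eq_of_eventuallyEq
    (fun z _ => hf.analyticAt z) analyticOnNhd_const (hq.locally_zero_iff.2 h)
  have hdiff (k : ℕ) : Differentiable ℂ ((Function.swap dslope c)^[k] f) := by
    induction k with
    | zero => exact hf
    | succ k ih => exact Function.iterate_succ_apply' _ k f ▸ differentiable_dslope ih c
  exact ⟨q.order, _, hdiff _, hq.iterate_dslope_fslope_ne_zero hq0,
    hq.eq_pow_order_mul_iterate_dslope⟩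

theorem exists_eq_pow_mul_pow_mul_of_ne_zero {f : ℂ → ℂ} (hf : Differentiable ℂ f) {c d : ℂ}
    (hne : ∀ z, z ≠ c → z ≠ d → f z ≠ 0) :
    ∃ (p s : ℕ) (g : ℂ → ℂ), Differentiable ℂ g ∧ (∀ z, g z ≠ 0) ∧
      ∀ z, f z = (z - c) ^ p * ((z - d) ^ s * g z) := by
  have hf0 : f ≠ 0 := by
    rintro rfl
    obtain ⟨z, hz⟩ := (Set.toFinite {c, d}).exists_notMem
    simp only [Set.mem_insert_iff, Set.mem_singleton_iff, not_or] at hz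
    exact hne z hz.1 hz.2 rfl
  obtain ⟨p, f₁, hf₁, hc, hp⟩ := exists_eq_pow_mul_of_differentiable hf hf0 c
  obtain ⟨s, g, hg, hd, hs⟩ :=
    exists_eq_pow_mul_of_differentiable hf₁ (fun h => hc (congrFun h c)) d
  have hfac z : f z = (z - c) ^ p * ((z - d) ^ s * g z) := by rw [hp, hs]
  refine ⟨p, s, g, hg, fun z hz => ?_, hfac⟩
  rcases eq_or_ne z c with rfl | hzc
  · exact hc (by rw [hs, hz, mul_zero])
  rcases eq_or_ne z d with rfl | hzd
  · exact hd hz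
  · exact hne z hzc hzd (by rw [hfac, hz, mul_zero, mul_zero])

theorem sub_mul_deriv_sub_pow_mul {g : ℂ → ℂ} {z : ℂ} (hg : DifferentiableAt ℂ g z) (c : ℂ)
    (p : ℕ) : (z - c) * deriv (fun z => (z - c) ^ p * g z) z =
      (z - c) ^ p * (p * g z + (z - c) * deriv g z) := by
  have hderiv := ((((hasDerivAt_id' z).sub_const c).fun_pow p).fun_mul hg.hasDerivAt).deriv
  rw [hderiv]
  rcases p with _ | p
  · simp
  · rw [Nat.add_sub_cancel]
    ring

theorem exists_eq_pow_mul_and_mul_deriv_eq {H : ℂ → ℂ} (hH : Differentiable ℂ H)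
    (hne : ∀ z, z ≠ 0 → z ≠ 1 → H z ≠ 0) :
    ∃ (p : ℕ) (K G : ℂ → ℂ), Differentiable ℂ K ∧ (∀ z, H z = z ^ p * K z) ∧
      Differentiable ℂ G ∧ G 0 = p ∧ ∀ z, z * (1 - z) * deriv H z = G z * H z := by
  obtain ⟨p, s, E, hE, hE0, hfac⟩ := exists_eq_pow_mul_pow_mul_of_ne_zero hH hne
  set K : ℂ → ℂ := fun z => (z - 1) ^ s * E z
  have hK : Differentiable ℂ K := by fun_prop
  have : Differentiable ℂ fun z => deriv E z / E z := hE.deriv.fun_div hE hE0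
  refine ⟨p, K, fun z => p * (1 - z) - s * z + z * (1 - z) * (deriv E z / E z), hK,
    fun z => by rw [hfac, sub_zero], by fun_prop, by simp, fun z => ?_⟩
  have hH' := sub_mul_deriv_sub_pow_mul (hK z) 0 p
  have hK' : (z - 1) * deriv K z = _ := sub_mul_deriv_sub_pow_mul (hE z) 1 s
  rw [← funext hfac] at hH'
  have hE0z := hE0 z
  rw [hfac]
  field_simp
  linear_combination (1 - z) * hH' - z ^ (p + 1) * hK'

end Factorization

section Exponent

theorem IsBiorthogonal.circleIntegral_weight_ne_zero {ν : ℂ → ℂ} {Φ Ψ : ℕ → ℂ[X]} {h : ℕ → ℂ}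
    (hΦ : IsBiorthogonal ν Φ Ψ h) : (∮ z in C(0, 1), ν z / (I * z)) ≠ 0 := by
  have hΦ₀ : Φ 0 = 1 := (hΦ.monic_left 0).natDegree_eq_zero.1 (hΦ.degree_left 0)
  have hΨ₀ : Ψ 0 = 1 := (hΦ.monic_right 0).natDegree_eq_zero.1 (hΦ.degree_right 0)
  have horth := hΦ.orthogonal 0 0
  simp only [hΦ₀, hΨ₀, eval_one, map_one, one_mul, if_pos] at horth
  exact horth ▸ hΦ.norm_ne_zero 0

variable {H K : ℂ → ℂ}

theorem jacobiWeight_natCast (k : ℕ) (H : ℂ → ℂ) (z : ℂ) :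
    jacobiWeight k H z = (1 - z) ^ (2 * k) * H z / (-z) ^ k := by
  have hexp : (k : ℂ) + conj (k : ℂ) = (2 * k : ℕ) := by
    rw [conj_natCast, Nat.cast_mul, Nat.cast_ofNat, two_mul]
  rw [jacobiWeight, hexp, conj_natCast, cpow_neg, cpow_natCast, cpow_natCast]
  ring

theorem circleIntegral_jacobiWeight_natCast_eq_zero (hK : Differentiable ℂ K) (k m : ℕ)
    (hH : ∀ z, H z = z ^ (m + 1 + k) * K z) :
    (∮ z in C(0, 1), jacobiWeight k H z / (I * z)) = 0 := by
  have hentire : Differentiable ℂ fun z => (1 - z) ^ (2 * k) * (z ^ m * K z) / ((-1) ^ k * I) := by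
    fun_prop
  have hcauchy := circleIntegral_eq_zero_of_differentiable_on_off_countable (c := 0) zero_le_one
    Set.countable_empty hentire.continuous.continuousOn fun z _ => hentire z
  refine (circleIntegral.integral_congr zero_le_one fun z hz => ?_).trans hcauchy
  have hz0 : z ≠ 0 := ne_zero_of_mem_unit_sphere ⟨z, hz⟩
  have hI := I_ne_zero
  simp only [jacobiWeight_natCast, hH, neg_pow z k]
  field_simp
  ring

theorem exists_eq_natCast_of_conj_eq {b : ℂ} (hb : -1 / 2 < b.re) {p n : ℕ}
    (h : conj b = p - n) : ∃ k : ℕ, b = k ∧ p = n + k := by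
  have hbpn : b = p - n := by simpa using congrArg conj h
  have hnp : n ≤ p := by
    by_contra! hlt
    have hcast : (p : ℝ) + 1 ≤ n := by exact_mod_cast hlt
    rw [hbpn, sub_re, natCast_re, natCast_re] at hb
    linarith
  obtain ⟨k, rfl⟩ := Nat.exists_eq_add_of_le hnp
  exact ⟨k, by rw [hbpn, Nat.cast_add, add_sub_cancel_left], rfl⟩

-- A vanishing exponent would make `ν(z) / z` the restriction of an entire function to the circle,
-- and the zeroth moment would be zero.
theorem IsBiorthogonal.jacobiPearsonCoeff_zero_ne_zero {b : ℂ} {G : ℂ → ℂ} {Φ Ψ : ℕ → ℂ[X]}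
    {h : ℕ → ℂ} {p : ℕ} (hΦ : IsBiorthogonal (jacobiWeight b H) Φ Ψ h) (hb : -1 / 2 < b.re)
    (hK : Differentiable ℂ K) (hH : ∀ z, H z = z ^ p * K z) (hG : G 0 = p) (m : ℕ) :
    jacobiPearsonCoeff b G (m + 1) 0 ≠ 0 := by
  intro hzero
  have hconj : conj b = p - (m + 1 : ℕ) := by
    rw [jacobiPearsonCoeff, hG] at hzero
    linear_combination -hzero
  obtain ⟨k, rfl, rfl⟩ := exists_eq_natCast_of_conj_eq hb hconj
  exact hΦ.circleIntegral_weight_ne_zero (circleIntegral_jacobiWeight_natCast_eq_zero hK k m hH)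

end Exponent

section Branches

variable {b z₀ : ℂ} {H G : ℂ → ℂ} {n : ℕ} {C : ℂ → Matrix (Fin 2) (Fin 2) ℂ}

theorem exists_analyticAt_exp_eventuallyEq {g : ℂ → ℂ} (hg : AnalyticAt ℂ g z₀) (h0 : g z₀ ≠ 0) :
    ∃ L : ℂ → ℂ, AnalyticAt ℂ L z₀ ∧ ∀ᶠ z in 𝓝 z₀, exp (L z) = g z := by
  have hslit : g z₀ / g z₀ ∈ slitPlane := div_self h0 ▸ one_mem_slitPlane
  refine ⟨fun z => log (g z / g z₀) + log (g z₀), by fun_prop (disch := assumption), ?_⟩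
  filter_upwards [hg.continuousAt.eventually_ne h0] with z hz
  rw [Complex.exp_add, exp_log (div_ne_zero hz h0), exp_log h0, div_mul_cancel₀ _ h0]

theorem exists_isCBranchAt (b : ℂ) (hH : AnalyticAt ℂ H z₀) (n : ℕ) (h0 : z₀ ≠ 0) (h1 : z₀ ≠ 1)
    (hH0 : H z₀ ≠ 0) : ∃ C, IsCBranchAt b H n z₀ C := by
  obtain ⟨L₀, hL₀, e₀⟩ := exists_analyticAt_exp_eventuallyEq analyticAt_id h0
  obtain ⟨L₁, hL₁, e₁⟩ := exists_analyticAt_exp_eventuallyEq (g := fun z => -z) (by fun_prop)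
    (neg_ne_zero.2 h0)
  obtain ⟨L₂, hL₂, e₂⟩ := exists_analyticAt_exp_eventuallyEq (g := fun z => 1 - z) (by fun_prop)
    (sub_ne_zero.2 h1.symm)
  obtain ⟨L₃, hL₃, e₃⟩ := exists_analyticAt_exp_eventuallyEq hH hH0
  set r : ℂ → ℂ := fun z => exp ((-conj b * L₁ z + (b + conj b) * L₂ z + L₃ z) / 2)
  refine ⟨fun z => !![exp (-(n / 2 : ℂ) * L₀ z) * r z, 0; 0, exp ((n / 2 : ℂ) * L₀ z) * (r z)⁻¹],
    L₀, L₁, L₂, r, hL₀, hL₁, hL₂, by fun_prop, ?_⟩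
  filter_upwards [e₀, e₁, e₂, e₃] with z e₀ e₁ e₂ e₃
  refine ⟨e₀, e₁, e₂, ?_, rfl⟩
  rw [← e₃, ← Complex.exp_nat_mul, ← Complex.exp_add, ← Complex.exp_add, Nat.cast_ofNat,
    mul_div_cancel₀ _ two_ne_zero]

theorem deriv_eq_of_exp_eventuallyEq {L g : ℂ → ℂ} (hL : DifferentiableAt ℂ L z₀)
    (hexp : ∀ᶠ z in 𝓝 z₀, exp (L z) = g z) : deriv g z₀ = g z₀ * deriv L z₀ := by
  rw [← EventuallyEq.deriv_eq hexp, deriv_cexp hL, hexp.self_of_nhds]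

theorem two_mul_deriv_mul_of_sq_eventuallyEq {c ℓ : ℂ → ℂ} (hc : DifferentiableAt ℂ c z₀)
    (hℓ : DifferentiableAt ℂ ℓ z₀) (hH : DifferentiableAt ℂ H z₀) (hc0 : c z₀ ≠ 0)
    (hsq : ∀ᶠ z in 𝓝 z₀, c z ^ 2 = exp (ℓ z) * H z) :
    2 * deriv c z₀ * H z₀ = (deriv ℓ z₀ * H z₀ + deriv H z₀) * c z₀ := by
  have hderiv := EventuallyEq.deriv_eq hsq
  rw [(hc.hasDerivAt.fun_pow 2).deriv, (hℓ.hasDerivAt.cexp.fun_mul hH.hasDerivAt).deriv] at hderiv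
  refine mul_left_cancel₀ hc0 ?_
  linear_combination H z₀ * hderiv -
    (deriv ℓ z₀ * H z₀ + deriv H z₀) * hsq.self_of_nhds

theorem mul_deriv_log_combination {L₀ L₁ L₂ : ℂ → ℂ} (m a s : ℂ)
    (hL₀ : DifferentiableAt ℂ L₀ z₀) (hL₁ : DifferentiableAt ℂ L₁ z₀)
    (hL₂ : DifferentiableAt ℂ L₂ z₀) (e₀ : ∀ᶠ z in 𝓝 z₀, exp (L₀ z) = z)
    (e₁ : ∀ᶠ z in 𝓝 z₀, exp (L₁ z) = -z) (e₂ : ∀ᶠ z in 𝓝 z₀, exp (L₂ z) = 1 - z) :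
    z₀ * (1 - z₀) * deriv (fun z => m * L₀ z + (a * L₁ z + s * L₂ z)) z₀ =
      m * (1 - z₀) + (a * (1 - z₀) - s * z₀) := by
  have hL₀' : 1 = z₀ * deriv L₀ z₀ := by simpa using deriv_eq_of_exp_eventuallyEq hL₀ e₀
  have hL₁' : 1 = z₀ * deriv L₁ z₀ := by simpa using deriv_eq_of_exp_eventuallyEq hL₁ e₁
  have hL₂' : -1 = (1 - z₀) * deriv L₂ z₀ := by simpa using deriv_eq_of_exp_eventuallyEq hL₂ e₂
  have hderiv := ((hL₀.hasDerivAt.const_mul m).fun_add ((hL₁.hasDerivAt.const_mul a).fun_add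
    (hL₂.hasDerivAt.const_mul s))).deriv
  rw [hderiv]
  linear_combination -m * (1 - z₀) * hL₀' - a * (1 - z₀) * hL₁' - s * z₀ * hL₂'

theorem IsCBranchAt.exists_sq_eventuallyEq (hC : IsCBranchAt b H n z₀ C) :
    ∃ c ℓ : ℂ → ℂ, DifferentiableAt ℂ c z₀ ∧ DifferentiableAt ℂ ℓ z₀ ∧
      (∀ᶠ z in 𝓝 z₀, C z = !![c z, 0; 0, (c z)⁻¹]) ∧
      (∀ᶠ z in 𝓝 z₀, c z ^ 2 = exp (ℓ z) * H z) ∧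
      z₀ * (1 - z₀) * deriv ℓ z₀ =
        -n * (1 - z₀) + (-conj b * (1 - z₀) - (b + conj b) * z₀) := by
  obtain ⟨L₀, L₁, L₂, r, hL₀, hL₁, hL₂, hr, hev⟩ := hC
  have hℓ' := mul_deriv_log_combination (-n) (-conj b) (b + conj b)
    hL₀.differentiableAt hL₁.differentiableAt hL₂.differentiableAt
    (hev.mono fun z hz => hz.1) (hev.mono fun z hz => hz.2.1) (hev.mono fun z hz => hz.2.2.1)
  refine ⟨fun z => exp (-(n / 2 : ℂ) * L₀ z) * r z, _, by fun_prop, by fun_prop,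
    hev.mono fun z hz => ?_, hev.mono fun z hz => ?_, hℓ'⟩
  · have hexp : exp ((n / 2 : ℂ) * L₀ z) = (exp (-(n / 2 : ℂ) * L₀ z))⁻¹ := by
      rw [← Complex.exp_neg, neg_mul, neg_neg]
    rw [hz.2.2.2.2, hexp, mul_inv]
  · have hexp : exp (-(n / 2 : ℂ) * L₀ z) ^ 2 = exp (-n * L₀ z) := by
      rw [← Complex.exp_nat_mul]
      congr 1
      push_cast
      ring
    rw [mul_pow, hz.2.2.2.1, hexp, Complex.exp_add, Complex.exp_add]
    ring

theorem IsCBranchAt.exists_hasDerivAt (hC : IsCBranchAt b H n z₀ C)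
    (hH : DifferentiableAt ℂ H z₀) (hG : z₀ * (1 - z₀) * deriv H z₀ = G z₀ * H z₀)
    (h0 : z₀ ≠ 0) (h1 : z₀ ≠ 1) (hH0 : H z₀ ≠ 0) :
    ∃ c : ℂ → ℂ, c z₀ ≠ 0 ∧
      HasDerivAt c (jacobiPearsonCoeff b G n z₀ / (2 * (z₀ * (1 - z₀))) * c z₀) z₀ ∧
      ∀ᶠ z in 𝓝 z₀, C z = !![c z, 0; 0, (c z)⁻¹] := by
  obtain ⟨c, ℓ, hc, hℓ, hCc, hsq, hℓ'⟩ := hC.exists_sq_eventuallyEq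
  have hc0 : c z₀ ≠ 0 := by
    refine ne_zero_pow two_ne_zero ?_
    rw [hsq.self_of_nhds]
    exact mul_ne_zero (Complex.exp_ne_zero _) hH0
  have hc' := two_mul_deriv_mul_of_sq_eventuallyEq hc hℓ hH hc0 hsq
  refine ⟨c, hc0, hc.hasDerivAt.congr_deriv ?_, hCc⟩
  have h1' : 1 - z₀ ≠ 0 := sub_ne_zero.2 h1.symm
  rw [jacobiPearsonCoeff]
  field_simp
  refine mul_left_cancel₀ hH0 ?_
  linear_combination z₀ * (1 - z₀) * hc' + H z₀ * c z₀ * hℓ' + c z₀ * hG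

variable {Y : ℂ → Matrix (Fin 2) (Fin 2) ℂ}

theorem matDeriv_mul_mul_inv_of_eventuallyEq_diagonal {c : ℂ → ℂ} {v : ℂ} (hc0 : c z₀ ≠ 0)
    (hc : HasDerivAt c (v * c z₀) z₀) (hC : ∀ᶠ z in 𝓝 z₀, C z = !![c z, 0; 0, (c z)⁻¹])
    (hY : ∀ i j, DifferentiableAt ℂ (fun z => Y z i j) z₀) :
    matDeriv (fun z => Y z * C z) z₀ * (Y z₀ * C z₀)⁻¹ =
      (matDeriv Y z₀ + Y z₀ * v • pauliZ) * (Y z₀)⁻¹ := by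
  have hcinv : HasDerivAt (fun z => (c z)⁻¹) (-v * (c z₀)⁻¹) z₀ :=
    (hc.fun_inv hc0).congr_deriv (by field_simp)
  have hC' i j : HasDerivAt (fun z => C z i j) ((v • pauliZ * C z₀) i j) z₀ := by
    have hCij : (fun z => C z i j) =ᶠ[𝓝 z₀] fun z => !![c z, 0; 0, (c z)⁻¹] i j :=
      hC.mono fun z hz => congrFun (congrFun hz i) j
    refine HasDerivAt.congr_of_eventuallyEq ?_ hCij
    rw [hC.self_of_nhds, pauliZ]
    fin_cases i <;> fin_cases j
    · simpa using hc
    · simpa using hasDerivAt_const z₀ (0 : ℂ)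
    · simpa using hasDerivAt_const z₀ (0 : ℂ)
    · simpa using hcinv
  refine matDeriv_mul_mul_inv hY (fun i j => (hC' i j).differentiableAt) ?_
    (Matrix.ext fun i j => (hC' i j).deriv)
  rw [hC.self_of_nhds, Matrix.det_fin_two_of]
  simp [hc0]

theorem IsCBranchAt.matDeriv_mul_mul_inv (hC : IsCBranchAt b H n z₀ C)
    (hH : DifferentiableAt ℂ H z₀) (hG : z₀ * (1 - z₀) * deriv H z₀ = G z₀ * H z₀)
    (h0 : z₀ ≠ 0) (h1 : z₀ ≠ 1) (hH0 : H z₀ ≠ 0)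
    (hY : ∀ i j, DifferentiableAt ℂ (fun z => Y z i j) z₀) :
    matDeriv (fun z => Y z * C z) z₀ * (Y z₀ * C z₀)⁻¹ =
      (matDeriv Y z₀ + Y z₀ * (jacobiPearsonCoeff b G n z₀ / (2 * (z₀ * (1 - z₀)))) • pauliZ) *
        (Y z₀)⁻¹ := by
  obtain ⟨c, hc0, hc, hCc⟩ := hC.exists_hasDerivAt hH hG h0 h1 hH0
  exact matDeriv_mul_mul_inv_of_eventuallyEq_diagonal hc0 hc hCc hY

end Branches

section Poles

variable {q : ℂ → ℂ} {a : ℂ}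

theorem meromorphicAt_inv_mul {f : ℂ → ℂ} (hq : AnalyticAt ℂ q a) (hf : AnalyticAt ℂ f a) :
    MeromorphicAt (fun z => (q z)⁻¹ * f z) a :=
  hq.meromorphicAt.inv.mul hf.meromorphicAt

theorem meromorphicOrderAt_inv_mul {f : ℂ → ℂ} (hq : AnalyticAt ℂ q a) (hqa : q a = 0)
    (hq' : deriv q a ≠ 0) (hf : AnalyticAt ℂ f a) :
    meromorphicOrderAt (fun z => (q z)⁻¹ * f z) a =
      -1 + (analyticOrderAt f a).map Nat.cast := by
  have hfun : (fun z => (q z)⁻¹ * f z) = q⁻¹ * f := rfl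
  rw [hfun, meromorphicOrderAt_mul hq.meromorphicAt.inv hf.meromorphicAt, meromorphicOrderAt_inv,
    hq.meromorphicOrderAt_eq, hf.meromorphicOrderAt_eq,
    hq.analyticOrderAt_eq_one_of_zero_deriv_ne_zero hqa hq']
  rfl

variable {N : ℂ → Matrix (Fin 2) (Fin 2) ℂ}

theorem hasSimplePoleAt_inv_smul (hq : AnalyticAt ℂ q a) (hqa : q a = 0) (hq' : deriv q a ≠ 0)
    (hN : ∀ i j, AnalyticAt ℂ (fun z => N z i j) a) (hNa : N a ≠ 0) :
    HasSimplePoleAt (fun z => (q z)⁻¹ • N z) a := by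
  refine ⟨fun i j => ⟨meromorphicAt_inv_mul hq (hN i j), ?_⟩, ?_⟩
  · refine (meromorphicOrderAt_inv_mul hq hqa hq' (hN i j)).ge.trans' ?_
    exact le_add_of_nonneg_right ((hN i j).meromorphicOrderAt_eq ▸
      (hN i j).meromorphicOrderAt_nonneg)
  · obtain ⟨i, j, hij⟩ : ∃ i j, N a i j ≠ 0 := by
      by_contra! hzero
      exact hNa (Matrix.ext hzero)
    refine ⟨i, j, (meromorphicOrderAt_inv_mul hq hqa hq' (hN i j)).trans ?_⟩
    rw [(hN i j).analyticOrderAt_eq_zero.2 hij]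
    rfl

theorem hasRemovableSingularityAt_inv_smul (hq : AnalyticAt ℂ q a) (hqa : q a = 0)
    (hq' : deriv q a ≠ 0) (hN : ∀ i j, AnalyticAt ℂ (fun z => N z i j) a) (hNa : N a = 0) :
    HasRemovableSingularityAt (fun z => (q z)⁻¹ • N z) a := by
  refine fun i j => ⟨meromorphicAt_inv_mul hq (hN i j), ?_⟩
  refine (meromorphicOrderAt_inv_mul hq hqa hq' (hN i j)).ge.trans' ?_
  have horder : analyticOrderAt (fun z => N z i j) a ≠ 0 :=
    (hN i j).analyticOrderAt_ne_zero.2 (congrFun (congrFun hNa i) j)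
  generalize analyticOrderAt (fun z => N z i j) a = o at horder
  cases o with
  | top => exact le_top
  | coe k =>
    have hk : k ≠ 0 := by simpa using horder
    have hk' : (0 : ℤ) ≤ -1 + k := by omega
    exact WithTop.coe_le_coe.2 hk'

end Poles

section StructureMatrix

variable {b : ℂ} {H G : ℂ → ℂ} {Φ Ψ : ℕ → ℂ[X]} {h : ℕ → ℂ} {m : ℕ}

/-- The matrix function `z (1 - z) M_n(z)` for `n = m + 1`, continued across the unit circle, where
`G = z (1 - z) H' / H`. -/
noncomputable def jacobiStructureNumerator (b : ℂ) (H G : ℂ → ℂ) (Φ Ψ : ℕ → ℂ[X]) (h : ℕ → ℂ)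
    (m : ℕ) : ℂ → Matrix (Fin 2) (Fin 2) ℂ :=
  structureNumerator 0 1 (fun t => t * (1 - t)) (jacobiPearsonCoeff b G (m + 1))
    (fun t => jacobiWeight b H t / t ^ (m + 1)) (fun t => (Φ (m + 1)).eval t)
    (fun t => (recip m (Ψ m)).eval t) (-(2 * Real.pi / h m))

theorem deriv_mul_one_sub (z : ℂ) : deriv (fun z => z * (1 - z)) z = 1 - 2 * z := by
  rw [((hasDerivAt_id' z).fun_mul ((hasDerivAt_id' z).const_sub 1)).deriv]
  ring

theorem differentiable_jacobiPearsonCoeff (hG : Differentiable ℂ G) (b : ℂ) (n : ℕ) :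
    Differentiable ℂ (jacobiPearsonCoeff b G n) := by
  unfold jacobiPearsonCoeff
  fun_prop

theorem differentiable_jacobiStructureNumerator (hν : CircleIntegrable (jacobiWeight b H) 0 1)
    (hG : Differentiable ℂ G) (i j : Fin 2) :
    Differentiable ℂ fun z => jacobiStructureNumerator b H G Φ Ψ h m z i j :=
  differentiable_structureNumerator zero_le_one (circleIntegrable_div_pow hν _) (by fun_prop)
    (differentiable_jacobiPearsonCoeff hG b _) (Φ (m + 1)).differentiable
    (recip m (Ψ m)).differentiable i j

theorem IsBiorthogonal.jacobiStructureNumerator_zero_ne_zero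
    (hΦ : IsBiorthogonal (jacobiWeight b H) Φ Ψ h) (hb : -1 / 2 < b.re)
    (hH : Differentiable ℂ H) (hG : Differentiable ℂ G)
    (hHG : ∀ z, z * (1 - z) * deriv H z = G z * H z)
    (hV : jacobiPearsonCoeff b G (m + 1) 0 ≠ 0) :
    jacobiStructureNumerator b H G Φ Ψ h m 0 ≠ 0 := by
  have hν := circleIntegrable_jacobiWeight hb hH.continuous
  have h0 : (0 : ℂ) ∉ Metric.sphere 0 1 := by simp
  have hdet := hΦ.det_Ymat hν m h0
  rw [Ymat_succ] at hdet
  exact (isPearson_jacobiWeight_div_pow hb hH hHG (m + 1)).structureNumerator_ne_zero zero_le_one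
    (circleIntegrable_div_pow hν _) (by fun_prop)
    (differentiable_jacobiPearsonCoeff hG b _).continuous (Φ (m + 1)).differentiable
    (recip m (Ψ m)).differentiable h0 (zero_mul _) hV (hdet ▸ one_ne_zero)

theorem IsBiorthogonal.isStructureMatrixAt
    (hΦ : IsBiorthogonal (jacobiWeight b H) Φ Ψ h) (hb : -1 / 2 < b.re)
    (hH : Differentiable ℂ H) (hG : Differentiable ℂ G)
    (hHG : ∀ z, z * (1 - z) * deriv H z = G z * H z)
    {z : ℂ} (hz : z ∉ Metric.sphere 0 1) (hz0 : z ≠ 0) (hHz : H z ≠ 0) :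
    IsStructureMatrixAt b H Φ Ψ h (m + 1) z
      ((z * (1 - z))⁻¹ • jacobiStructureNumerator b H G Φ Ψ h m z) := by
  have hν := circleIntegrable_jacobiWeight hb hH.continuous
  have hw := circleIntegrable_div_pow hν (m + 1)
  have hz1 : z ≠ 1 := by
    rintro rfl
    simp at hz
  refine ⟨exists_isCBranchAt b (hH.analyticAt z) (m + 1) hz0 hz1 hHz, fun C hC => ?_⟩
  have hY := differentiableAt_cauchyMatrix (κ := -(2 * Real.pi / h m)) zero_le_one hw
    (Φ (m + 1)).differentiable (recip m (Ψ m)).differentiable hz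
  have hdet := hΦ.det_Ymat hν m hz
  rw [Ymat_succ] at hdet ⊢
  rw [hC.matDeriv_mul_mul_inv (hH z) (hHG z) hz0 hz1 hHz hY]
  exact (isPearson_jacobiWeight_div_pow hb hH hHG (m + 1)).inv_smul_structureNumerator_eq
    zero_le_one hw (by fun_prop) (differentiable_jacobiPearsonCoeff hG b _).continuous
    (Φ (m + 1)).differentiable (recip m (Ψ m)).differentiable hz
    (mul_ne_zero hz0 (sub_ne_zero.2 hz1.symm)) hdet

end StructureMatrix

theorem mainTheorem10 (b : ℂ) (hb : -1 / 2 < b.re)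
    (H : ℂ → ℂ) (hH : Differentiable ℂ H) (hH0 : ∀ z, z ≠ 0 → z ≠ 1 → H z ≠ 0)
    (Φ Ψ : ℕ → ℂ[X]) (h : ℕ → ℂ) (hΦ : IsBiorthogonal (jacobiWeight b H) Φ Ψ h)
    (n : ℕ) (hn : 1 ≤ n) :
    ∃ M : ℂ → Matrix (Fin 2) (Fin 2) ℂ,
      (∀ z, ‖z‖ ≠ 1 → z ≠ 0 → IsStructureMatrixAt b H Φ Ψ h n z (M z)) ∧
      (∀ i j, DifferentiableOn ℂ (fun z => M z i j) {0, 1}ᶜ) ∧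
      HasSimplePoleAt M 0 ∧
      (HasRemovableSingularityAt M 1 ∨ HasSimplePoleAt M 1) := by
  obtain ⟨m, rfl⟩ : ∃ m, n = m + 1 := Nat.exists_eq_add_of_le' hn
  obtain ⟨p, K, G, hK, hHK, hG, hG0, hHG⟩ := exists_eq_pow_mul_and_mul_deriv_eq hH hH0
  have hν := circleIntegrable_jacobiWeight hb hH.continuous
  have hV := hΦ.jacobiPearsonCoeff_zero_ne_zero hb hK hHK hG0 m
  set N := jacobiStructureNumerator b H G Φ Ψ h m
  have hN i j : Differentiable ℂ fun z => N z i j :=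
    differentiable_jacobiStructureNumerator hν hG i j
  have hN0 : N 0 ≠ 0 := hΦ.jacobiStructureNumerator_zero_ne_zero hb hH hG hHG hV
  have hA : Differentiable ℂ fun z : ℂ => z * (1 - z) := by fun_prop
  refine ⟨fun z => (z * (1 - z))⁻¹ • N z, fun z hz hz0 => ?_, fun i j => ?_, ?_, ?_⟩
  · have hz1 : z ≠ 1 := fun hz1 => hz (hz1 ▸ norm_one)
    exact hΦ.isStructureMatrixAt hb hH hG hHG (by simpa using hz) hz0 (hH0 z hz0 hz1)
  · refine (hA.differentiableOn.inv fun z hz => ?_).mul (hN i j).differentiableOn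
    simp only [Set.mem_compl_iff, Set.mem_insert_iff, Set.mem_singleton_iff, not_or] at hz
    exact mul_ne_zero hz.1 (sub_ne_zero.2 (Ne.symm hz.2))
  · exact hasSimplePoleAt_inv_smul (hA.analyticAt 0) (zero_mul _)
      (by simp [deriv_mul_one_sub]) (fun i j => (hN i j).analyticAt 0) hN0
  · have hA1 : deriv (fun z : ℂ => z * (1 - z)) 1 ≠ 0 := by norm_num [deriv_mul_one_sub]
    exact (eq_or_ne (N 1) 0).imp
      (hasRemovableSingularityAt_inv_smul (hA.analyticAt 1) (by simp) hA1
        fun i j => (hN i j).analyticAt 1)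
      (hasSimplePoleAt_inv_smul (hA.analyticAt 1) (by simp) hA1 fun i j => (hN i j).analyticAt 1)
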